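/- Let $L_0[0,1]$ be the space of classes (modulo a.e. equality) of measurable real functions on $[0,1]$ with Lebesgue measure $m$. For $x\in L_0[0,1]$ put $\lambda_s(x)=m\{|x|>s\}$ and $\mu_t(x)=\inf\{s>0:\lambda_s(x)\le t\}$ ($t>0$). A *symmetric Banach space* on $[0,1]$ is a linear subspace $E\subseteq L_0[0,1]$ with a complete norm $\|\cdot\|_E$ such that $E$ contains all simple functions and such that, whenever $x\in E$, $y\in L_0[0,1]$ and $\mu_t(y)\le\mu_t(x)$ for all $t>0$, then $y\in E$ and $\|y\|_E\le\|x\|_E$. Such an $E$ is *$\alpha$-convex* (resp. *$\beta$-concave*) if there is $C>0$ such that for every finite sequence $(x_i)$ in $E$ $$\Big\|\big(\sum_i|x_i|^\alpha\big)^{1/\alpha}\Big\|_E\le C\Big(\sum_i\|x_i\|_E^\alpha\Big)^{1/\alpha}\quad\text{(resp. }\Big\|\big(\sum_i|x_i|^\beta\big)^{1/\beta}\Big\|_E\ge C^{-1}\Big(\sum_i\|x_i\|_E^\beta\Big)^{1/\beta}\text{)}.$$ For a space $G\subseteq L_0[0,1]$ with a norm or quasi-norm, let $G^{(1/2)}=\{x:|x|^{1/2}\in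 G\}$ with $\|x\|_{G^{(1/2)}}=\||x|^{1/2}\|_G^{2}$, and let $G^\times$ be the set of all $y\in L_0[0,1]$ with $\|y\|_{G^\times}=\sup\{\int_0^1|xy|\,dm:\ x\in G,\ \|x\|_G\le1\}<\infty$. Let $G_1\odot G_2=\{x_1x_2: x_i\in G_i\}$, with $\|x\|_{G_1\odot G_2}=\inf\{\|x_1\|_{G_1}\|x_2\|_{G_2}: x=x_1x_2,\ x_i\in G_i\}$. **Proposition 1.3.** Let $E$ be a symmetric Banach space on $[0,1]$ which is $\alpha$-convex and $\beta$-concave for some $\alpha>1$ and some $1<\beta<2$, and let $F=\big((E^\times)^{(1/2)}\big)^\times$. Then $$E=F\odot E^\times$$ with equivalent (quasi-)norms, that is, the two sides are the same set of functions and there are constants $c,C>0$ with $c\|x\|_E\le\|x\|_{F\odot E^\times}\le C\|x\|_E$ for all $x\in E$. Moreover, $F$ is separable for its norm $\|\cdot\|_F$. -/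

import Mathlib

open MeasureTheory Filter Topology
open scoped ENNReal NNReal

noncomputable section

/-- `L₀[0,1]`: classes (modulo a.e. equality) of measurable real functions on `[0,1]` with
Lebesgue measure. -/
abbrev LZero : Type := unitInterval →ₘ[(volume : Measure unitInterval)] ℝ

/-- The class of `|x|^p`, for a real exponent `p`. -/
def absPow (p : ℝ) (x : LZero) : LZero :=
  x.compMeasurable (fun r : ℝ => |r| ^ p) (by fun_prop)

/-- The distribution function `λ_s(x) = m {ω : |x ω| > s}`. -/
def distribution (x : LZero) (s : ℝ) : ℝ :=
  (volume : Measure unitInterval).real {ω | s < |x ω|}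

/-- The decreasing rearrangement `μ_t(x) = inf {s > 0 : λ_s(x) ≤ t}`, used for `t > 0`
(where the set is nonempty). -/
def rearrangement (x : LZero) (t : ℝ) : ℝ :=
  sInf {s : ℝ | 0 < s ∧ distribution x s ≤ t}

/-- A linear space `E ⊆ L₀[0,1]` with a (quasi-)norm is encoded by the extension
`ρ : L₀ → [0,∞]` of its (quasi-)norm by the value `∞` outside `E`; this is the space `E`. -/
def spaceOf (ρ : LZero → ℝ≥0∞) : Set LZero := {x | ρ x < ∞}

/-- `ρ` is (the extension by `∞` of) the norm of a symmetric Banach space on `[0,1]`: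
a complete normed space of classes of measurable functions that contains the simple functions
and satisfies `y ∈ E`, `‖y‖ ≤ ‖x‖` whenever `x ∈ E` and `μ(y) ≤ μ(x)`
(so that it is in particular a Banach lattice for the a.e. order). -/
structure IsSymmetricBanachSpace (ρ : LZero → ℝ≥0∞) : Prop where
  eq_zero : ∀ x, ρ x = 0 → x = 0
  smul : ∀ (c : ℝ) (x : LZero), ρ (c • x) = ENNReal.ofReal |c| * ρ x
  add_le : ∀ x y : LZero, ρ (x + y) ≤ ρ x + ρ y
  complete : ∀ u : ℕ → LZero, (∀ n, u n ∈ spaceOf ρ) →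
    (∀ ε : ℝ≥0∞, 0 < ε → ∃ N, ∀ m ≥ N, ∀ n ≥ N, ρ (u m - u n) < ε) →
    ∃ x ∈ spaceOf ρ, Tendsto (fun n => ρ (u n - x)) atTop (𝓝 0)
  simple_mem : ∀ f : SimpleFunc unitInterval ℝ,
    (AEEqFun.mk f f.measurable.aestronglyMeasurable : LZero) ∈ spaceOf ρ
  symmetric : ∀ x y : LZero, x ∈ spaceOf ρ →
    (∀ t : ℝ, 0 < t → rearrangement y t ≤ rearrangement x t) → y ∈ spaceOf ρ ∧ ρ y ≤ ρ x

/-- `α`-convexity: `‖(∑ |x_i|^α)^{1/α}‖ ≤ C (∑ ‖x_i‖^α)^{1/α}` for all finite sequences. -/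
def IsLatticeConvex (α : ℝ) (ρ : LZero → ℝ≥0∞) : Prop :=
  ∃ C : ℝ≥0, 0 < C ∧ ∀ (n : ℕ) (x : Fin n → LZero), (∀ i, x i ∈ spaceOf ρ) →
    ρ (absPow (1 / α) (∑ i, absPow α (x i))) ≤ C * (∑ i, ρ (x i) ^ α) ^ (1 / α)

/-- `β`-concavity: `‖(∑ |x_i|^β)^{1/β}‖ ≥ C⁻¹ (∑ ‖x_i‖^β)^{1/β}` for all finite sequences. -/
def IsLatticeConcave (β : ℝ) (ρ : LZero → ℝ≥0∞) : Prop :=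
  ∃ C : ℝ≥0, 0 < C ∧ ∀ (n : ℕ) (x : Fin n → LZero), (∀ i, x i ∈ spaceOf ρ) →
    ((C⁻¹ : ℝ≥0) : ℝ≥0∞) * (∑ i, ρ (x i) ^ β) ^ (1 / β) ≤
      ρ (absPow (1 / β) (∑ i, absPow β (x i)))

/-- The space `E^{(p)} = {x : |x|^p ∈ E}`, with `‖x‖ = ‖|x|^p‖_E^{1/p}`. -/
def powerSpace (p : ℝ) (ρ : LZero → ℝ≥0∞) : LZero → ℝ≥0∞ :=
  fun x => ρ (absPow p x) ^ (1 / p)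

/-- The Köthe dual `E^×`: `‖y‖ = sup {∫ |x y| : ‖x‖_E ≤ 1}`, and `y ∈ E^×` iff this is finite. -/
def kotheDual (ρ : LZero → ℝ≥0∞) : LZero → ℝ≥0∞ :=
  fun y => ⨆ (x : LZero) (_ : ρ x ≤ 1), ∫⁻ t : unitInterval, ENNReal.ofReal |x t * y t|

/-- The pointwise product `E₁ ⊙ E₂`: `‖x‖ = inf {‖x₁‖ ‖x₂‖ : x = x₁ x₂, x_i ∈ E_i}`
(which is `∞` if there is no such factorization). -/
def pointwiseProduct (ρ₁ ρ₂ : LZero → ℝ≥0∞) : LZero → ℝ≥0∞ :=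
  fun x => ⨅ (x₁ : LZero) (x₂ : LZero) (_ : x₁ ∈ spaceOf ρ₁) (_ : x₂ ∈ spaceOf ρ₂)
    (_ : x = x₁ * x₂), ρ₁ x₁ * ρ₂ x₂

/-- The underlying set of `E₁ ⊙ E₂` is the set of all products `x₁ x₂`, `x_i ∈ E_i`. -/
theorem mem_spaceOf_pointwiseProduct (ρ₁ ρ₂ : LZero → ℝ≥0∞) (x : LZero) :
    x ∈ spaceOf (pointwiseProduct ρ₁ ρ₂) ↔
      ∃ x₁ ∈ spaceOf ρ₁, ∃ x₂ ∈ spaceOf ρ₂, x = x₁ * x₂ := by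
  simp only [spaceOf, pointwiseProduct, Set.mem_ofPred_eq, iInf_lt_iff]
  constructor
  · rintro ⟨x₁, x₂, h₁, h₂, h, -⟩
    exact ⟨x₁, h₁, x₂, h₂, h⟩
  · rintro ⟨x₁, h₁, x₂, h₂, h⟩
    exact ⟨x₁, x₂, h₁, h₂, h, ENNReal.mul_lt_top h₁ h₂⟩

/-- Equality of (quasi-)normed function spaces: the same elements, with equivalent
(quasi-)norms. -/
def EqualSpaces (ρ₁ ρ₂ : LZero → ℝ≥0∞) : Prop :=
  spaceOf ρ₁ = spaceOf ρ₂ ∧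
    ∃ c C : ℝ≥0, 0 < c ∧ 0 < C ∧ ∀ x ∈ spaceOf ρ₁, c * ρ₁ x ≤ ρ₂ x ∧ ρ₂ x ≤ C * ρ₁ x

/-- Separability: some countable subset of the space is dense in it for the (quasi-)norm. -/
def IsSeparableSpace (ρ : LZero → ℝ≥0∞) : Prop :=
  ∃ D : Set LZero, D.Countable ∧ D ⊆ spaceOf ρ ∧
    ∀ x ∈ spaceOf ρ, ∀ ε : ℝ≥0∞, 0 < ε → ∃ d ∈ D, ρ (x - d) < ε

end

/-! Concavity enters only through a lower estimate: if `∑ |y_i|^β ≤ |x|^β` then `∑ ‖y_i‖^β ≤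
(C‖x‖)^β`. It makes norm-bounded increasing sequences Cauchy, so completeness gives the Fatou
property, and Hahn–Banach in `L²` then recovers the norm of `E` from the unit ball of `E^×`
(`le_of_forall_lintegral_le`). By duality `E^×` is `q`-convex for the conjugate exponent `q > 2`,
and also 2-convex, since a lower `β`-estimate implies a lower 2-estimate.

The inclusion of `F ⊙ E^×` in `E` is Cauchy–Schwarz: write `|fg|u = (|f|^{1/2}|g|)(|f|^{1/2}u)` and
test against `u` in the unit ball of `E^×` (`le_mul_of_product`).

For the converse, fix `x ∈ E` and maximize `∫ |x| g` over the functions `(∑ u_i²)^{1/2}` with `∑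
‖u_i‖² ≤ 1`, norms in `E^×`. By 2-convexity this hull is bounded in `E^×`. Squares of its elements
form a convex set and the square root is strictly concave, so maximizing sequences converge in
`L¹(|x| dm)` (`exists_maximizing_limit`). Moving the maximizer `g₀` towards `u` along `(a²g₀² +
b²u²)^{1/2}` gives `∫ |x| u² / (2 g₀) ≤ sup` (`lintegral_div_le_hullSup`), which says that `x / g₀`
lies in `F`. Thus `x = (x / g₀) g₀` is the factorization. Convexity of `E` is used only for `1 ∈
E^×`, which forces `x` to vanish where `g₀` does.

Separability of `F` rests on order continuity of its norm (`exists_sqDualNorm_le_of_antitone`): a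
decreasing sequence that stays large in `F` would give growth `N` against at most `N^{2/q}`,
impossible as `q > 2`. Together with `1 ∈ F` this makes truncations of a countable dense subset of
`L¹` dense in `F`. -/

/-! ### Rearrangements, pointwise formulas and the lattice property. -/

theorem exists_distribution_le (x : LZero) {t : ℝ} (ht : 0 < t) :
    ∃ s, 0 < s ∧ distribution x s ≤ t := by
  have h := tendsto_measure_iInter_atTop (μ := (volume : Measure unitInterval))
    (s := fun n : ℕ => {ω | (n : ℝ) < |x ω|})
    (fun n => (measurableSet_lt measurable_const
      (x.measurable.abs)).nullMeasurableSet)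
    (fun m n hmn ω (hω : (n : ℝ) < |x ω|) =>
      lt_of_le_of_lt (Nat.cast_le.2 hmn) hω) ⟨0, measure_ne_top _ _⟩
  have h0 : (⋂ n : ℕ, {ω | (n : ℝ) < |x ω|}) = ∅ := by
    ext ω
    simp only [Set.mem_iInter, Set.mem_ofPred_eq, Set.mem_empty_iff_false, iff_false, not_forall,
      not_lt]
    exact exists_nat_ge _
  rw [h0, measure_empty] at h
  obtain ⟨n, hn, hn0⟩ := ((h.eventually (gt_mem_nhds (ENNReal.ofReal_pos.2 ht))).and
    (eventually_gt_atTop 0)).exists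
  refine ⟨n, by exact_mod_cast hn0, ?_⟩
  exact ENNReal.toReal_le_of_le_ofReal ht.le hn.le

theorem rearrangement_le_of_distribution_le {x y : LZero}
    (h : ∀ s, 0 < s → distribution y s ≤ distribution x s) {t : ℝ} (ht : 0 < t) :
    rearrangement y t ≤ rearrangement x t := by
  apply csInf_le_csInf
  · exact ⟨0, fun s hs => hs.1.le⟩
  · exact exists_distribution_le x ht
  · exact fun s hs => ⟨hs.1, (h s hs.1).trans hs.2⟩

theorem coeFn_absPow (p : ℝ) (x : LZero) : absPow p x =ᵐ[volume] fun t => |x t| ^ p :=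
  AEEqFun.coeFn_compMeasurable _ _ _

theorem LZero.coeFn_sum {ι : Type*} (s : Finset ι) (x : ι → LZero) :
    (∑ i ∈ s, x i : LZero) =ᵐ[volume] fun t => ∑ i ∈ s, x i t := by
  classical
  induction s using Finset.induction_on with
  | empty =>
    simp only [Finset.sum_empty]
    exact AEEqFun.coeFn_zero
  | insert a s ha ih =>
    rw [Finset.sum_insert ha]
    filter_upwards [AEEqFun.coeFn_add (x a) (∑ i ∈ s, x i), ih] with t h1 h2
    rw [h1, Pi.add_apply, h2, Finset.sum_insert ha]

theorem coeFn_absPow_sum {n : ℕ} (p q : ℝ) (x : Fin n → LZero) :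
    absPow q (∑ i, absPow p (x i)) =ᵐ[volume] fun t => (∑ i, |x i t| ^ p) ^ q := by
  filter_upwards [coeFn_absPow q (∑ i, absPow p (x i)),
    LZero.coeFn_sum Finset.univ (fun i => absPow p (x i)),
    ae_all_iff.2 fun i => coeFn_absPow p (x i)] with t h1 h2 h3
  rw [h1, h2]
  simp only [h3]
  rw [abs_of_nonneg (Finset.sum_nonneg fun i _ => Real.rpow_nonneg (abs_nonneg _) _)]

namespace IsSymmetricBanachSpace

variable {E : LZero → ℝ≥0∞} (hE : IsSymmetricBanachSpace E)
include hE

theorem le_of_distribution_le {x y : LZero}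
    (h : ∀ s, 0 < s → distribution y s ≤ distribution x s) : E y ≤ E x := by
  by_cases hx : E x < ∞
  · exact (hE.symmetric x y hx fun t ht => rearrangement_le_of_distribution_le h ht).2
  · simp only [not_lt, top_le_iff] at hx
    simp [hx]

theorem mono {x y : LZero} (h : ∀ᵐ t, |y t| ≤ |x t|) : E y ≤ E x := by
  refine hE.le_of_distribution_le fun s _ => ?_
  refine ENNReal.toReal_mono (measure_ne_top _ _) (measure_mono_ae ?_)
  filter_upwards [h] with t ht
  exact fun h' => lt_of_lt_of_le h' ht

theorem congr_abs {x y : LZero} (h : ∀ᵐ t, |y t| = |x t|) : E y = E x :=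
  le_antisymm (hE.mono (h.mono fun _ h => h.le)) (hE.mono (h.mono fun _ h => h.ge))

theorem map_zero : E 0 = 0 := by simpa using hE.smul 0 0

theorem sub_le (x y : LZero) : E (x - y) ≤ E x + E y := by
  have := hE.add_le x (-y)
  rwa [← sub_eq_add_neg, hE.congr_abs (x := y) (y := -y)] at this
  filter_upwards [AEEqFun.coeFn_neg y] with t ht
  simp [ht]

end IsSymmetricBanachSpace

/-! ### Lower estimates. -/

/-- `(∑ ‖y_i‖^β)^{1/β} ≤ C ‖x‖` whenever `∑ |y_i|^β ≤ |x|^β`. -/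
def LowerEstimate (β : ℝ) (C : ℝ≥0) (E : LZero → ℝ≥0∞) : Prop :=
  ∀ (n : ℕ) (y : Fin n → LZero) (x : LZero), E x < ∞ →
    (∀ᵐ t, ∑ i, |y i t| ^ β ≤ |x t| ^ β) → ∑ i, E (y i) ^ β ≤ (C * E x) ^ β

theorem abs_le_of_sum_rpow_le {n : ℕ} {β : ℝ} (hβ : 0 < β) {a : Fin n → ℝ} {b : ℝ}
    (h : ∑ i, |a i| ^ β ≤ |b| ^ β) (i : Fin n) : |a i| ≤ |b| := by
  refine (Real.rpow_le_rpow_iff (abs_nonneg _) (abs_nonneg _) hβ).1 (le_trans ?_ h)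
  exact Finset.single_le_sum (f := fun i => |a i| ^ β)
    (fun i _ => Real.rpow_nonneg (abs_nonneg _) _) (Finset.mem_univ i)

theorem IsLatticeConcave.lowerEstimate {E : LZero → ℝ≥0∞} (hE : IsSymmetricBanachSpace E)
    {β : ℝ} (hβ : 0 < β) (h : IsLatticeConcave β E) : ∃ C : ℝ≥0, 0 < C ∧ LowerEstimate β C E := by
  obtain ⟨C, hC, h⟩ := h
  refine ⟨C, hC, fun n y x hx hyx => ?_⟩
  have hy : ∀ i, E (y i) ≤ E x := fun i => hE.mono <| by
    filter_upwards [hyx] with t ht using abs_le_of_sum_rpow_le hβ ht i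
  have h1 := h n y fun i => (hy i).trans_lt hx
  have h2 : E (absPow (1 / β) (∑ i, absPow β (y i))) ≤ E x := hE.mono <| by
    filter_upwards [hyx, coeFn_absPow_sum β (1 / β) y] with t ht h2
    have h0 : 0 ≤ ∑ i, |y i t| ^ β :=
      Finset.sum_nonneg fun i _ => Real.rpow_nonneg (abs_nonneg _) _
    rw [h2, abs_of_nonneg (Real.rpow_nonneg h0 _)]
    calc _ ≤ (|x t| ^ β) ^ (1 / β) := Real.rpow_le_rpow h0 ht (by positivity)
      _ = |x t| := by rw [← Real.rpow_mul (abs_nonneg _), mul_one_div_cancel hβ.ne', Real.rpow_one]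
  have h3 := h1.trans h2
  rw [ENNReal.coe_inv hC.ne', ENNReal.inv_mul_le_iff (by simpa using hC.ne') (by simp)] at h3
  calc _ = ((∑ i, E (y i) ^ β) ^ (1 / β)) ^ β := by
        rw [← ENNReal.rpow_mul, one_div_mul_cancel hβ.ne', ENNReal.rpow_one]
    _ ≤ _ := ENNReal.rpow_le_rpow h3 hβ.le

/-- Hölder with exponents `q/(q-β)` and `q/β` reduces the `q`-estimate to the `β`-estimate for
rescaled functions, without loss in the constant. The case `q = 2` supplies the 2-convexity of
`E^×`. -/
theorem LowerEstimate.of_le {E : LZero → ℝ≥0∞} (hE : IsSymmetricBanachSpace E) {β q : ℝ}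
    {C : ℝ≥0} (hβ : 0 < β) (hq : β < q) (h : LowerEstimate β C E) : LowerEstimate q C E := by
  intro n y x hx hyx
  have hq0 : 0 < q := hβ.trans hq
  have hqβ : 0 < q - β := sub_pos.2 hq
  have hy : ∀ i, E (y i) < ∞ := fun i => (hE.mono (by
    filter_upwards [hyx] with t ht using abs_le_of_sum_rpow_le hq0 ht i)).trans_lt hx
  obtain ⟨e, he⟩ : ∃ e : Fin n → ℝ≥0, ∀ i, E (y i) = e i :=
    ⟨fun i => (E (y i)).toNNReal, fun i => (ENNReal.coe_toNNReal (hy i).ne).symm⟩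
  obtain ⟨X, hX⟩ : ∃ X : ℝ≥0, E x = X := ⟨_, (ENNReal.coe_toNNReal hx.ne).symm⟩
  set T : ℝ≥0 := ∑ i, e i ^ q with hT
  -- The weights are chosen so that the left side of the `β`-estimate becomes `∑ e_i^{q-β} e_i^β =
  -- T`; the factor on `x` is what Hölder costs. Cancelling `T^{(q-β)/q}` leaves `T^{β/q} ≤
  -- (C‖x‖)^β`.
  have key := h n (fun i => ((e i ^ ((q - β) / β) : ℝ≥0) : ℝ) • y i)
    (((T ^ ((q - β) / (q * β)) : ℝ≥0) : ℝ) • x) (by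
      rw [hE.smul]; exact ENNReal.mul_lt_top ENNReal.ofReal_lt_top hx) (by
      filter_upwards [hyx, AEEqFun.coeFn_smul ((T ^ ((q - β) / (q * β)) : ℝ≥0) : ℝ) x,
        ae_all_iff.2 fun i => AEEqFun.coeFn_smul ((e i ^ ((q - β) / β) : ℝ≥0) : ℝ) (y i)]
        with t ht h1 h2
      simp only [h1, h2, Pi.smul_apply, smul_eq_mul, abs_mul, NNReal.abs_eq]
      have hc : (q / (q - β)).HolderConjugate (q / β) := by
        rw [Real.holderConjugate_iff]
        constructor
        · rw [lt_div_iff₀ hqβ]; linarith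
        · field_simp; ring
      have h3 := Real.inner_le_Lp_mul_Lq_of_nonneg Finset.univ hc
        (f := fun i => ((e i : ℝ) ^ (q - β))) (g := fun i => |y i t| ^ β)
        (fun i _ => by positivity) (fun i _ => by positivity)
      calc ∑ i, (((e i ^ ((q - β) / β) : ℝ≥0) : ℝ) * |y i t|) ^ β
          = ∑ i, ((e i : ℝ) ^ (q - β)) * |y i t| ^ β := by
            refine Finset.sum_congr rfl fun i _ => ?_
            rw [Real.mul_rpow (by positivity) (by positivity), NNReal.coe_rpow,
              ← Real.rpow_mul (by positivity), div_mul_cancel₀ _ hβ.ne']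
        _ ≤ _ := h3
        _ ≤ (T : ℝ) ^ ((q - β) / q) * (|x t| ^ q) ^ (β / q) := by
            rw [one_div_div, one_div_div]
            have e1 : ∑ i, ((e i : ℝ) ^ (q - β)) ^ (q / (q - β)) = T := by
              rw [hT, NNReal.coe_sum]
              refine Finset.sum_congr rfl fun i _ => ?_
              rw [← Real.rpow_mul (by positivity), mul_div_cancel₀ _ hqβ.ne', NNReal.coe_rpow]
            have e2 : ∑ i, (|y i t| ^ β) ^ (q / β) = ∑ i, |y i t| ^ q := by
              refine Finset.sum_congr rfl fun i _ => ?_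
              rw [← Real.rpow_mul (by positivity), mul_div_cancel₀ _ hβ.ne']
            rw [e1, e2]
            gcongr
        _ = _ := by
            rw [Real.mul_rpow (by positivity) (by positivity), NNReal.coe_rpow,
              ← Real.rpow_mul (by positivity), ← Real.rpow_mul (by positivity)]
            congr 2 <;> field_simp)
  simp only [hE.smul, NNReal.abs_eq, ENNReal.ofReal_coe_nnreal, he, hX] at key ⊢
  norm_cast at key
  have e3 : ∀ i, (e i ^ ((q - β) / β) * e i) ^ β = e i ^ q := fun i => by
    rw [NNReal.mul_rpow, ← NNReal.rpow_mul, div_mul_cancel₀ _ hβ.ne']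
    rcases eq_or_ne (e i) 0 with h0 | h0
    · simp [h0, hβ.ne', hq0.ne']
    · rw [← NNReal.rpow_add h0]; congr 1; ring
  have key2 : T ≤ (C * (T ^ ((q - β) / (q * β)) * X)) ^ β := by
    have : ((∑ i, (e i ^ ((q - β) / β) * e i) ^ β : ℝ≥0) : ℝ≥0∞) ≤
        (((C * (T ^ ((q - β) / (q * β)) * X)) ^ β : ℝ≥0) : ℝ≥0∞) := by
      convert key using 1
      · push_cast
        refine Finset.sum_congr rfl fun i _ => ?_
        rw [ENNReal.coe_rpow_of_nonneg _ hβ.le]; push_cast; rfl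
      · rw [ENNReal.coe_rpow_of_nonneg _ hβ.le]
    simp only [e3] at this
    exact_mod_cast this
  have key3 : T ≤ (C * X) ^ q := by
    rcases eq_or_ne T 0 with h0 | h0
    · simp [h0]
    · have e4 : (C * (T ^ ((q - β) / (q * β)) * X)) ^ β = T ^ ((q - β) / q) * (C * X) ^ β := by
        rw [mul_left_comm, NNReal.mul_rpow, ← NNReal.rpow_mul]
        congr 2; field_simp
      rw [e4] at key2
      have e5 : T = T ^ ((q - β) / q) * T ^ (β / q) := by
        rw [← NNReal.rpow_add h0]
        have : (q - β) / q + β / q = 1 := by field_simp; ring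
        rw [this, NNReal.rpow_one]
      have h4 : T ^ ((q - β) / q) * T ^ (β / q) ≤ T ^ ((q - β) / q) * (C * X) ^ β := e5 ▸ key2
      have h5 := le_of_mul_le_mul_left h4 (NNReal.rpow_pos (pos_iff_ne_zero.2 h0))
      have h6 := NNReal.rpow_le_rpow h5 (z := q / β) (by positivity)
      rwa [← NNReal.rpow_mul, ← NNReal.rpow_mul, div_mul_div_cancel₀ hq0.ne',
        div_self hβ.ne', mul_div_cancel₀ _ hβ.ne', NNReal.rpow_one] at h6
  have : ((∑ i, e i ^ q : ℝ≥0) : ℝ≥0∞) ≤ (((C * X) ^ q : ℝ≥0) : ℝ≥0∞) := by exact_mod_cast key3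
  convert this using 1
  · push_cast
    refine Finset.sum_congr rfl fun i _ => ?_
    rw [ENNReal.coe_rpow_of_nonneg _ hq0.le]
  · rw [ENNReal.coe_rpow_of_nonneg _ hq0.le]; push_cast; rfl

/-! ### The Fatou property. -/

/-- The class of a measurable nonnegative function. -/
noncomputable def nnClass (u : unitInterval → ℝ≥0) (hu : Measurable u) : LZero :=
  AEEqFun.mk (fun t => (u t : ℝ)) hu.coe_nnreal_real.aestronglyMeasurable

theorem coeFn_nnClass (u : unitInterval → ℝ≥0) (hu : Measurable u) :
    nnClass u hu =ᵐ[volume] fun t => (u t : ℝ) := AEEqFun.coeFn_mk _ _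

theorem LZero.measurable_nnnorm (x : LZero) : Measurable fun t => ‖x t‖₊ := x.measurable.nnnorm

theorem sum_sub_rpow_le {β : ℝ} (hβ : 1 ≤ β) {a : ℕ → ℝ} (h0 : 0 ≤ a 0)
    (h : ∀ n, a n ≤ a (n + 1)) (n : ℕ) :
    ∑ j ∈ Finset.range n, |a (j + 1) - a j| ^ β ≤ a n ^ β := by
  have hm : Monotone a := monotone_nat_of_le_succ h
  induction n with
  | zero => simpa using Real.rpow_nonneg h0 _
  | succ n ih =>
    rw [Finset.sum_range_succ, abs_of_nonneg (sub_nonneg.2 (h n))]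
    calc _ ≤ a n ^ β + (a (n + 1) - a n) ^ β := by gcongr
      _ ≤ (a n + (a (n + 1) - a n)) ^ β :=
        Real.add_rpow_le_rpow_add (h0.trans (hm (Nat.zero_le _))) (sub_nonneg.2 (h n)) hβ
      _ = _ := by ring_nf

theorem tendsto_iInf_add_of_tendsto {a : ℕ → ℝ≥0} {b : ℝ≥0} (h : Tendsto a atTop (𝓝 b)) :
    Tendsto (fun n => ⨅ k, a (n + k)) atTop (𝓝 b) := by
  have hle : ∀ n, ⨅ k, a (n + k) ≤ a n := fun n => ciInf_le (OrderBot.bddBelow _) 0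
  refine tendsto_order.2 ⟨fun c hc => ?_, fun c hc => ?_⟩
  · obtain ⟨d, hcd, hd⟩ := exists_between hc
    obtain ⟨N, hN⟩ := eventually_atTop.1 ((tendsto_order.1 h).1 d hd)
    filter_upwards [eventually_ge_atTop N] with n hn
    exact hcd.trans_le (le_ciInf fun k => (hN _ (by omega)).le)
  · filter_upwards [(tendsto_order.1 h).2 c hc] with n hn using (hle n).trans_lt hn

theorem monotone_iInf_add (a : ℕ → ℝ≥0) (n : ℕ) : ⨅ k, a (n + k) ≤ ⨅ k, a (n + 1 + k) := by
  refine le_ciInf fun k => ?_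
  have := ciInf_le (f := fun k => a (n + k)) (OrderBot.bddBelow _) (k + 1)
  rwa [show n + (k + 1) = n + 1 + k by ring] at this

namespace IsSymmetricBanachSpace

variable {E : LZero → ℝ≥0∞} (hE : IsSymmetricBanachSpace E)
include hE

-- Otherwise infinitely many successive increments along a subsequence have norm at least `ε`. Since
-- `r ↦ r^β` is superadditive, the `β`-th powers of `J` of them sum to at most `x_J^β` along that
-- subsequence, so `J ε^β ≤ (C M)^β` for every `J`.
omit hE in
theorem exists_sub_lt_of_monotone {β : ℝ} (hβ : 1 ≤ β) {C : ℝ≥0} (h : LowerEstimate β C E)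
    {x : ℕ → LZero} (h0 : ∀ᵐ t, 0 ≤ x 0 t) (hm : ∀ᵐ t, ∀ n, x n t ≤ x (n + 1) t)
    {M : ℝ≥0∞} (hM : M < ∞) (hx : ∀ n, E (x n) ≤ M) {ε : ℝ≥0∞} (hε : 0 < ε) :
    ∃ N, ∀ m ≥ N, E (x m - x N) < ε := by
  by_contra! hcon
  choose f hf hfε using hcon
  set φ : ℕ → ℕ := fun j => f^[j] 0 with hφ
  have hφs : ∀ j, φ (j + 1) = f (φ j) := fun j => Function.iterate_succ_apply' f j 0
  have key : ∀ J : ℕ, (J : ℝ≥0∞) * ε ^ β ≤ (C * M) ^ β := fun J => by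
    have h1 := h J (fun i => x (φ (i + 1)) - x (φ i)) (x (φ J)) ((hx _).trans_lt hM) (by
      filter_upwards [h0, hm, ae_all_iff.2 fun j => AEEqFun.coeFn_sub (x (φ (j + 1))) (x (φ j))]
        with t ht0 ht hs
      have hmt : Monotone fun n => x n t := monotone_nat_of_le_succ ht
      have h2 := sum_sub_rpow_le hβ (a := fun j => x (φ j) t) ht0
        (fun j => hmt (by rw [hφs]; exact hf _)) J
      rw [← Fin.sum_univ_eq_sum_range (fun j => |x (φ (j + 1)) t - x (φ j) t| ^ β)] at h2
      simp only [hs, Pi.sub_apply]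
      rwa [abs_of_nonneg (ht0.trans (hmt (Nat.zero_le _)))])
    calc (J : ℝ≥0∞) * ε ^ β = ∑ i : Fin J, ε ^ β := by simp
      _ ≤ _ := by
        refine Finset.sum_le_sum fun i _ => ENNReal.rpow_le_rpow ?_ (by linarith)
        rw [hφs]; exact hfε _
      _ ≤ _ := h1
      _ ≤ _ := by gcongr; exact hx _
  obtain ⟨J, hJ⟩ := ENNReal.exists_nat_mul_gt (a := ε ^ β) (b := (C * M) ^ β)
    (ENNReal.rpow_pos_of_nonneg hε (by linarith)).ne'
    (ENNReal.rpow_ne_top_of_nonneg (by linarith) (ENNReal.mul_ne_top (by simp) hM.ne))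
  exact (key J).not_gt hJ

/-- The sequence is Cauchy, hence has a norm limit `y`. As `(x_n - y)⁺ ≤ |x_m - y|` for `m ≥ n`,
letting `m → ∞` gives `x_n ≤ y`, so `0 ≤ z ≤ y`; there is no need to identify `y` with `z`. -/
theorem le_of_monotone_tendsto {β : ℝ} (hβ : 1 ≤ β) {C : ℝ≥0} (h : LowerEstimate β C E)
    {x : ℕ → LZero} (h0 : ∀ᵐ t, 0 ≤ x 0 t) (hm : ∀ᵐ t, ∀ n, x n t ≤ x (n + 1) t)
    {M : ℝ≥0∞} (hx : ∀ n, E (x n) ≤ M) {z : LZero}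
    (hz : ∀ᵐ t, Tendsto (fun n => x n t) atTop (𝓝 (z t))) : E z ≤ M := by
  rcases eq_or_ne M ∞ with rfl | hM
  · exact le_top
  replace hM := hM.lt_top
  obtain ⟨y, -, hy⟩ := hE.complete x (fun n => (hx n).trans_lt hM) (by
    intro ε hε
    obtain ⟨N, hN⟩ := exists_sub_lt_of_monotone hβ h h0 hm hM hx (ENNReal.half_pos hε.ne')
    refine ⟨N, fun m hm n hn => ?_⟩
    have : x m - x n = (x m - x N) - (x n - x N) := by abel
    rw [this, ← ENNReal.add_halves ε]
    exact (hE.sub_le _ _).trans_lt (ENNReal.add_lt_add (hN m hm) (hN n hn)))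
  have hle : ∀ n, ∀ᵐ t, x n t ≤ y t := fun n => by
    have h1 : E ((x n - y) ⊔ 0) = 0 := by
      refine le_antisymm (ge_of_tendsto hy ?_) zero_le
      filter_upwards [eventually_ge_atTop n] with m hmn
      apply hE.mono
      filter_upwards [hm, AEEqFun.coeFn_sub (x n) y, AEEqFun.coeFn_sub (x m) y,
        AEEqFun.coeFn_sup (x n - y) 0, AEEqFun.coeFn_zero (β := ℝ) (μ := volume)]
        with t ht h1 h2 h3 h4
      have hmt : x n t ≤ x m t := monotone_nat_of_le_succ ht hmn
      rw [h3, h1, h2, h4, Pi.sub_apply, Pi.sub_apply, Pi.zero_apply,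
        abs_of_nonneg le_sup_right]
      exact sup_le ((sub_le_sub_right hmt _).trans (le_abs_self _)) (abs_nonneg _)
    have h2 := hE.eq_zero _ h1
    filter_upwards [AEEqFun.coeFn_sub (x n) y, AEEqFun.coeFn_sup (x n - y) 0,
      AEEqFun.coeFn_zero (β := ℝ) (μ := (volume : Measure unitInterval))] with t h3 h4 h5
    rw [h2, h5, h3, Pi.zero_apply, Pi.sub_apply] at h4
    exact sub_nonpos.1 (le_sup_left.trans h4.symm.le)
  have hzy : E z ≤ E y := by
    apply hE.mono
    filter_upwards [hz, h0, hm, ae_all_iff.2 hle] with t h1 h2 h3 h4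
    have hmt : Monotone fun n => x n t := monotone_nat_of_le_succ h3
    have hz0 : 0 ≤ z t := ge_of_tendsto' h1 fun n => h2.trans (hmt (Nat.zero_le n))
    have hzy : z t ≤ y t := le_of_tendsto' h1 h4
    rw [abs_of_nonneg hz0]
    exact hzy.trans (le_abs_self _)
  refine hzy.trans ?_
  have h5 : Tendsto (fun n => E (x n - y) + M) atTop (𝓝 (0 + M)) := hy.add tendsto_const_nhds
  rw [zero_add] at h5
  refine ge_of_tendsto' h5 fun n => ?_
  calc E y = E (x n - (x n - y)) := by congr 1; abel
    _ ≤ E (x n) + E (x n - y) := hE.sub_le _ _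
    _ ≤ _ := by rw [add_comm]; gcongr; exact hx n

theorem congr_nnClass (x : LZero) : E (nnClass _ x.measurable_nnnorm) = E x := by
  apply hE.congr_abs
  filter_upwards [coeFn_nnClass _ x.measurable_nnnorm] with t ht
  simp [ht]

/-- The tail infima of `|y_n|` increase to `|z|` and are dominated by `|y_n|`, which reduces the
claim to increasing sequences. -/
theorem le_of_ae_tendsto {β : ℝ} (hβ : 1 ≤ β) {C : ℝ≥0} (h : LowerEstimate β C E)
    {y : ℕ → LZero} {M : ℝ≥0∞} (hy : ∀ n, E (y n) ≤ M) {z : LZero}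
    (hz : ∀ᵐ t, Tendsto (fun n => y n t) atTop (𝓝 (z t))) : E z ≤ M := by
  have hmeas : ∀ n, Measurable fun t => ⨅ k, ‖y (n + k) t‖₊ :=
    fun n => Measurable.iInf fun k => (y (n + k)).measurable_nnnorm
  have hc := ae_all_iff.2 fun n => coeFn_nnClass _ (hmeas n)
  rw [← hE.congr_nnClass z]
  refine hE.le_of_monotone_tendsto hβ h (x := fun n => nnClass _ (hmeas n)) ?_ ?_ ?_ ?_
  · filter_upwards [hc] with t ht
    rw [ht]; positivity
  · filter_upwards [hc] with t ht n
    rw [ht, ht]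
    exact_mod_cast monotone_iInf_add (fun k => ‖y k t‖₊) n
  · intro n
    refine le_trans (hE.mono ?_) (hy n)
    filter_upwards [hc] with t ht
    rw [ht, NNReal.abs_eq]
    exact ciInf_le (f := fun k => ‖y (n + k) t‖₊) (OrderBot.bddBelow _) 0
  · filter_upwards [hc, hz, coeFn_nnClass _ z.measurable_nnnorm] with t ht hzt h3
    simp only [ht, h3]
    exact (NNReal.continuous_coe.tendsto _).comp
      (tendsto_iInf_add_of_tendsto ((continuous_nnnorm.tendsto _).comp hzt))

end IsSymmetricBanachSpace

/-! ### Norms of indicator functions. -/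

/-- The class of the indicator function of a measurable set. -/
noncomputable def indClass (A : Set unitInterval) (hA : MeasurableSet A) : LZero :=
  nnClass (A.indicator 1) (measurable_one.indicator hA)

theorem coeFn_indClass (A : Set unitInterval) (hA : MeasurableSet A) :
    indClass A hA =ᵐ[volume] A.indicator 1 := by
  filter_upwards [coeFn_nnClass _ (measurable_one.indicator hA)] with t ht
  rw [indClass, ht]
  by_cases h : t ∈ A <;> simp [h]

theorem distribution_indClass (A : Set unitInterval) (hA : MeasurableSet A) {s : ℝ} (hs : 0 < s) :
    distribution (indClass A hA) s = if s < 1 then volume.real A else 0 := by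
  have : (volume : Measure unitInterval).real {ω | s < |indClass A hA ω|} =
      volume.real {ω | s < 1 ∧ ω ∈ A} := by
    refine measureReal_congr ?_
    filter_upwards [coeFn_indClass A hA] with t ht
    refine propext ?_
    change s < |indClass A hA t| ↔ s < 1 ∧ t ∈ A
    rw [ht]
    by_cases h : t ∈ A <;> simp [h, hs.le]
  rw [distribution, this]
  split_ifs with h <;> simp [h]

/-- The `i`-th of `n` consecutive intervals of length `1 / n`. -/
def gridCell (n i : ℕ) : Set unitInterval :=
  {t | (i : ℝ) / n ≤ t ∧ (t : ℝ) < (i + 1 : ℕ) / n}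

theorem measurableSet_gridCell (n i : ℕ) : MeasurableSet (gridCell n i) :=
  (measurableSet_le measurable_const measurable_subtype_coe).inter
    (measurableSet_lt measurable_subtype_coe measurable_const)

theorem volume_gridCell {n i : ℕ} (hi : i < n) :
    (volume : Measure unitInterval) (gridCell n i) = ENNReal.ofReal (1 / n) := by
  have hn : (0 : ℝ) < n := by exact_mod_cast (Nat.zero_le i).trans_lt hi
  have h : gridCell n i = Set.Ico (⟨i / n, by positivity, by
      rw [div_le_one hn]; exact_mod_cast hi.le⟩ : unitInterval) ⟨(i + 1 : ℕ) / n, by positivity, by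
      rw [div_le_one hn]; exact_mod_cast hi⟩ := by
    ext t
    simp [gridCell, Set.mem_Ico, ← Subtype.coe_le_coe, ← Subtype.coe_lt_coe]
  rw [h, unitInterval.volume_Ico]
  congr 1
  push_cast; field_simp; ring

theorem sum_indicator_gridCell {n : ℕ} (hn : 0 < n) {t : unitInterval} (ht : (t : ℝ) ≠ 1) :
    ∑ i : Fin n, (gridCell n i).indicator (1 : unitInterval → ℝ) t = 1 := by
  have hn' : (0 : ℝ) < n := by exact_mod_cast hn
  have ht1 : (t : ℝ) < 1 := lt_of_le_of_ne t.2.2 ht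
  have ht0 : (0 : ℝ) ≤ t := t.2.1
  have hk : ⌊(t : ℝ) * n⌋₊ < n := by
    rw [Nat.floor_lt (by positivity)]; nlinarith
  rw [Finset.sum_eq_single (⟨⌊(t : ℝ) * n⌋₊, hk⟩ : Fin n)]
  · rw [Set.indicator_of_mem]
    · rfl
    · refine ⟨?_, ?_⟩
      · rw [div_le_iff₀ hn']; exact Nat.floor_le (by positivity)
      · rw [lt_div_iff₀ hn']; push_cast; exact Nat.lt_floor_add_one _
  · intro j _ hj
    rw [Set.indicator_of_notMem]
    rintro ⟨h1, h2⟩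
    rw [div_le_iff₀ hn'] at h1
    rw [lt_div_iff₀ hn'] at h2
    refine hj (Fin.ext ?_)
    simp only
    symm
    rw [Nat.floor_eq_iff (by positivity)]
    exact ⟨h1, by push_cast at h2; exact h2⟩
  · simp

theorem ae_sum_indClass_gridCell {n : ℕ} (hn : 0 < n) {p : ℝ} (hp : 0 < p) :
    ∀ᵐ t, ∑ i : Fin n, |indClass (gridCell n i) (measurableSet_gridCell n i) t| ^ p = 1 := by
  have h1 : ∀ᵐ t : unitInterval, t ≠ 1 := by
    have : (volume : Measure unitInterval) {1} = 0 := by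
      simp
    exact compl_mem_ae_iff.2 this
  filter_upwards [h1, ae_all_iff.2 fun i : Fin n =>
    coeFn_indClass _ (measurableSet_gridCell n i)] with t ht h2
  rw [← sum_indicator_gridCell hn (t := t) (fun h => ht (Subtype.ext h))]
  refine Finset.sum_congr rfl fun i _ => ?_
  rw [h2]
  by_cases h : t ∈ gridCell n i <;> simp [h, hp.ne']

theorem LZero.coeFn_one : (1 : LZero) =ᵐ[volume] fun _ => (1 : ℝ) := AEEqFun.coeFn_one

namespace IsSymmetricBanachSpace

variable {E : LZero → ℝ≥0∞} (hE : IsSymmetricBanachSpace E)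
include hE

theorem indClass_mono {A B : Set unitInterval} (hA : MeasurableSet A) (hB : MeasurableSet B)
    (h : volume A ≤ volume B) : E (indClass A hA) ≤ E (indClass B hB) := by
  refine hE.le_of_distribution_le fun s hs => ?_
  rw [distribution_indClass _ _ hs, distribution_indClass _ _ hs]
  split_ifs
  · exact ENNReal.toReal_mono (measure_ne_top _ _) h
  · exact le_rfl

theorem map_one_lt_top : E 1 < ∞ := by
  have h := hE.simple_mem (SimpleFunc.const _ 1)
  exact h

theorem map_one_ne_zero : E 1 ≠ 0 := by
  intro h
  have h1 := hE.eq_zero _ h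
  have h2 := LZero.coeFn_one
  have h3 := AEEqFun.coeFn_zero (β := ℝ) (μ := (volume : Measure unitInterval))
  rw [h1] at h2
  obtain ⟨t, ht1, ht2⟩ := (h2.and h3).exists
  rw [ht1] at ht2
  exact one_ne_zero ht2

/-- With `a = m(A)`, cover `[0,1]` up to a null set by `n = ⌈1/a⌉` cells of length at most `a`. By
symmetry each cell has norm at most that of `A`; convexity gives `‖1‖^α ≤ C^α n ‖1_A‖^α`, and `n a ≤
2`. -/
theorem volume_le_of_convex {α : ℝ} (hα : 0 < α) (h : IsLatticeConvex α E) :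
    ∃ K : ℝ≥0, ∀ (A : Set unitInterval) (hA : MeasurableSet A),
      volume A ≤ K * E (indClass A hA) ^ α := by
  obtain ⟨C, hC, h⟩ := h
  have hE1 : E 1 ^ α ≠ 0 := by simp [hE.map_one_ne_zero, hα, hα.not_gt, hE.map_one_lt_top.ne]
  have hE1' : E 1 ^ α ≠ ∞ := ENNReal.rpow_ne_top_of_nonneg hα.le hE.map_one_lt_top.ne
  have hCα : (C : ℝ≥0∞) ^ α ≠ ∞ := ENNReal.rpow_ne_top_of_nonneg hα.le (by simp)
  refine ⟨(2 * C ^ α / E 1 ^ α : ℝ≥0∞).toNNReal, fun A hA => ?_⟩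
  rw [ENNReal.coe_toNNReal (ENNReal.div_ne_top (ENNReal.mul_ne_top (by simp) hCα) hE1)]
  rcases eq_or_ne (volume A) 0 with h0 | h0
  · simp [h0]
  set a := volume.real A with ha
  have ha0 : 0 < a := ENNReal.toReal_pos h0 (measure_ne_top _ _)
  have ha1 : a ≤ 1 := measureReal_le_one
  have hva : volume A = ENNReal.ofReal a := (ofReal_measureReal).symm
  set n := ⌈1 / a⌉₊ with hn
  have hn0 : 0 < n := Nat.ceil_pos.2 (by positivity)
  have hn1 : (1 : ℝ) / n ≤ a := by
    rw [div_le_iff₀ (by exact_mod_cast hn0), ← div_le_iff₀' ha0]; exact Nat.le_ceil _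
  have hn2 : (n : ℝ) * a ≤ 2 := by
    have := (Nat.ceil_lt_add_one (show 0 ≤ 1 / a by positivity)).le
    calc (n : ℝ) * a ≤ (1 / a + 1) * a := by gcongr
      _ = 1 + a := by field_simp
      _ ≤ 2 := by linarith
  have hcell : ∀ i : Fin n, E (indClass _ (measurableSet_gridCell n i)) ≤ E (indClass A hA) :=
    fun i => hE.indClass_mono _ _ (by
      rw [volume_gridCell i.2, hva]; exact ENNReal.ofReal_le_ofReal hn1)
  have h1 := h n (fun i => indClass _ (measurableSet_gridCell n i)) (fun i => by
    refine (hE.mono ?_).trans_lt hE.map_one_lt_top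
    filter_upwards [coeFn_indClass _ (measurableSet_gridCell n i), LZero.coeFn_one] with t h1 h2
    rw [h1, h2]
    by_cases h : t ∈ gridCell n i <;> simp [h])
  have h2 : E 1 ≤ C * (n * E (indClass A hA) ^ α) ^ (1 / α) := by
    calc E 1 ≤ _ := hE.mono (by
          filter_upwards [coeFn_absPow_sum α (1 / α)
            (fun i : Fin n => indClass _ (measurableSet_gridCell n i)), LZero.coeFn_one,
            ae_sum_indClass_gridCell hn0 hα] with t h1 h2 h3
          rw [h1, h2, h3]; simp)
      _ ≤ _ := h1
      _ ≤ _ := by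
        gcongr
        calc _ ≤ ∑ i : Fin n, E (indClass A hA) ^ α :=
              Finset.sum_le_sum fun i _ => ENNReal.rpow_le_rpow (hcell i) hα.le
          _ = _ := by simp
  have h3 : E 1 ^ α ≤ C ^ α * (n * E (indClass A hA) ^ α) := by
    have := ENNReal.rpow_le_rpow h2 hα.le
    rwa [ENNReal.mul_rpow_of_nonneg _ _ hα.le, ← ENNReal.rpow_mul, one_div_mul_cancel hα.ne',
      ENNReal.rpow_one] at this
  have h4 : (n : ℝ≥0∞) * volume A ≤ 2 := by
    rw [hva, ← ENNReal.ofReal_natCast, ← ENNReal.ofReal_mul (by positivity)]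
    exact (ENNReal.ofReal_le_ofReal hn2).trans (by simp)
  rw [ENNReal.mul_div_right_comm.symm, ENNReal.le_div_iff_mul_le (.inl hE1) (.inl hE1')]
  calc volume A * E 1 ^ α ≤ volume A * (C ^ α * (n * E (indClass A hA) ^ α)) := by gcongr
    _ = n * volume A * (C ^ α * E (indClass A hA) ^ α) := by ring
    _ ≤ 2 * (C ^ α * E (indClass A hA) ^ α) := by gcongr
    _ = _ := by ring

/-- The dual count: `n = ⌊1/a⌋` cells of length at least `a` give `n ‖1_A‖^β ≤ (C‖1‖)^β`, and `1 ≤ 2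
a n`. -/
theorem indClass_rpow_le {β : ℝ} (hβ : 0 < β) {C : ℝ≥0} (h : LowerEstimate β C E) :
    ∃ K : ℝ≥0, ∀ (A : Set unitInterval) (hA : MeasurableSet A),
      E (indClass A hA) ^ β ≤ K * volume A := by
  refine ⟨(2 * (C * E 1) ^ β : ℝ≥0∞).toNNReal, fun A hA => ?_⟩
  have hfin : (2 * (C * E 1) ^ β : ℝ≥0∞) ≠ ∞ := ENNReal.mul_ne_top (by simp)
    (ENNReal.rpow_ne_top_of_nonneg hβ.le (ENNReal.mul_ne_top (by simp) hE.map_one_lt_top.ne))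
  rw [ENNReal.coe_toNNReal hfin]
  rcases eq_or_ne (volume A) 0 with h0 | h0
  · have : E (indClass A hA) ≤ E (indClass ∅ .empty) := hE.indClass_mono _ _ (by simp [h0])
    have h1 : E (indClass ∅ .empty) ≤ E 0 := by
      apply hE.mono
      filter_upwards [coeFn_indClass ∅ .empty] with t ht
      simp [ht]
    rw [hE.map_zero] at h1
    simp [le_antisymm (this.trans h1) zero_le, hβ]
  set a := volume.real A with ha
  have ha0 : 0 < a := ENNReal.toReal_pos h0 (measure_ne_top _ _)
  have ha1 : a ≤ 1 := measureReal_le_one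
  have hva : volume A = ENNReal.ofReal a := (ofReal_measureReal).symm
  have hinv : 1 ≤ 1 / a := by rwa [le_div_iff₀ ha0, one_mul]
  set n := ⌊1 / a⌋₊ with hn
  have hn0 : 0 < n := Nat.floor_pos.2 hinv
  have hn1 : a ≤ (1 : ℝ) / n := by
    rw [le_div_iff₀ (by exact_mod_cast hn0), ← le_div_iff₀' ha0]
    exact Nat.floor_le (by positivity)
  have hn2 : 1 ≤ 2 * a * (n : ℝ) := by
    have h1 := (Nat.lt_floor_add_one (1 / a)).le
    rw [div_le_iff₀ ha0] at h1
    have : (1 : ℝ) ≤ n := by exact_mod_cast hn0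
    rw [← hn] at h1
    nlinarith
  have h1 := h n (fun i => indClass _ (measurableSet_gridCell n i)) 1 hE.map_one_lt_top (by
    filter_upwards [LZero.coeFn_one, ae_sum_indClass_gridCell hn0 hβ] with t h2 h3
    rw [h2, h3]; simp)
  have h2 : (n : ℝ≥0∞) * E (indClass A hA) ^ β ≤ (C * E 1) ^ β := by
    refine le_trans ?_ h1
    calc _ = ∑ i : Fin n, E (indClass A hA) ^ β := by simp
      _ ≤ _ := Finset.sum_le_sum fun i _ => ENNReal.rpow_le_rpow (hE.indClass_mono _ _ (by
          rw [volume_gridCell i.2, hva]; exact ENNReal.ofReal_le_ofReal hn1)) hβ.le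
  have h4 : 1 ≤ 2 * volume A * (n : ℝ≥0∞) := by
    rw [hva, ← ENNReal.ofReal_natCast, ← ENNReal.ofReal_ofNat, ← ENNReal.ofReal_mul (by positivity),
      ← ENNReal.ofReal_mul (by positivity)]
    simpa using hn2
  calc _ = 1 * E (indClass A hA) ^ β := (one_mul _).symm
    _ ≤ 2 * volume A * (n : ℝ≥0∞) * E (indClass A hA) ^ β := by gcongr
    _ = 2 * volume A * (n * E (indClass A hA) ^ β) := by ring
    _ ≤ 2 * volume A * (C * E 1) ^ β := by gcongr
    _ = _ := by ring

end IsSymmetricBanachSpace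

/-! ### Integral bounds. -/

theorem lintegral_le_of_weak_type {v : unitInterval → ℝ≥0} (hv : Measurable v) {r : ℝ}
    (hr : 1 < r) {K : ℝ≥0∞}
    (h : ∀ s : ℝ, 1 ≤ s → volume {t | s < v t} ≤ K * ENNReal.ofReal (s ^ (-r))) :
    ∫⁻ t, (v t : ℝ≥0∞) ≤ 1 + K * ENNReal.ofReal (1 / (r - 1)) := by
  have h1 := lintegral_eq_lintegral_meas_lt (volume : Measure unitInterval) (f := fun t => (v t : ℝ))
    (.of_forall fun t => by positivity) hv.coe_nnreal_real.aemeasurable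
  simp only [ENNReal.ofReal_coe_nnreal] at h1
  rw [h1, ← Set.Ioc_union_Ioi_eq_Ioi zero_le_one, lintegral_union measurableSet_Ioi
    (Set.Ioc_disjoint_Ioi le_rfl)]
  gcongr
  · calc _ ≤ ∫⁻ _ in Set.Ioc (0 : ℝ) 1, 1 := lintegral_mono fun s => prob_le_one
      _ = 1 := by simp
  · calc _ ≤ ∫⁻ s in Set.Ioi (1 : ℝ), K * ENNReal.ofReal (s ^ (-r)) :=
          setLIntegral_mono (by fun_prop) fun s hs => h s hs.le
      _ = K * ∫⁻ s in Set.Ioi (1 : ℝ), ENNReal.ofReal (s ^ (-r)) :=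
          lintegral_const_mul _ (by fun_prop)
      _ = _ := by
          congr 1
          rw [← ofReal_integral_eq_lintegral_ofReal
            (integrableOn_Ioi_rpow_of_lt (by linarith) one_pos), integral_Ioi_rpow_of_lt
            (by linarith) one_pos]
          · congr 1
            rw [Real.one_rpow, ← neg_div_neg_eq]; congr 1 <;> ring
          · exact (ae_restrict_iff' measurableSet_Ioi).2 (.of_forall fun s hs =>
              Real.rpow_nonneg (zero_le_one.trans (le_of_lt hs)) _)

/-- Fatou's lemma. The alternative `g t = 0` dispenses with convergence where the limit integrand
vanishes, notably on the zero set of `x`. -/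
theorem lintegral_le_of_ae_tendsto {Ω : Type*} [MeasurableSpace Ω] {μ : Measure Ω}
    {f : ℕ → Ω → ℝ≥0∞} {g : Ω → ℝ≥0∞} {K : ℝ≥0∞} (hf : ∀ n, Measurable (f n))
    (h : ∀ᵐ t ∂μ, g t = 0 ∨ Tendsto (fun n => f n t) atTop (𝓝 (g t)))
    (hK : ∀ n, ∫⁻ t, f n t ∂μ ≤ K) : ∫⁻ t, g t ∂μ ≤ K :=
  calc ∫⁻ t, g t ∂μ ≤ ∫⁻ t, liminf (fun n => f n t) atTop ∂μ := by
        refine lintegral_mono_ae ?_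
        filter_upwards [h] with t ht
        rcases ht with ht | ht
        · simp [ht]
        · exact ht.liminf_eq.ge
    _ ≤ liminf (fun n => ∫⁻ t, f n t ∂μ) atTop := lintegral_liminf_le hf
    _ ≤ K := (liminf_le_liminf (.of_forall hK)).trans (by simp)

/-! ### The Köthe dual norm on nonnegative functions. -/

/-- The Köthe dual functional `sup {∫ |x| u : ‖x‖ ≤ 1}` on nonnegative functions. -/
noncomputable def dualNorm (E : LZero → ℝ≥0∞) (u : unitInterval → ℝ≥0) : ℝ≥0∞ :=
  ⨆ (x : LZero) (_ : E x ≤ 1), ∫⁻ t, ‖x t‖ₑ * u t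

theorem kotheDual_eq_dualNorm (E : LZero → ℝ≥0∞) (y : LZero) :
    kotheDual E y = dualNorm E fun t => ‖y t‖₊ := by
  simp only [kotheDual, dualNorm]
  congr! 5 with x hx t
  rw [ENNReal.ofReal_eq_coe_nnreal (abs_nonneg _)]
  change _ = (‖x t‖₊ : ℝ≥0∞) * ‖y t‖₊
  rw [← ENNReal.coe_mul, ← nnnorm_mul]
  rfl

section dualNorm

variable {E : LZero → ℝ≥0∞} {u v : unitInterval → ℝ≥0}

theorem LZero.measurable_enorm (x : LZero) : Measurable fun t => ‖x t‖ₑ := x.measurable.enorm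

theorem LZero.measurable_enorm_mul (x : LZero) {f : unitInterval → ℝ≥0∞} (hf : Measurable f) :
    Measurable fun t => ‖x t‖ₑ * f t := x.measurable_enorm.mul hf

theorem dualNorm_le_iff {K : ℝ≥0∞} :
    dualNorm E u ≤ K ↔ ∀ x : LZero, E x ≤ 1 → ∫⁻ t, ‖x t‖ₑ * u t ≤ K := by
  simp only [dualNorm, iSup_le_iff]

theorem lintegral_le_dualNorm (x : LZero) (hx : E x ≤ 1) :
    ∫⁻ t, ‖x t‖ₑ * u t ≤ dualNorm E u := dualNorm_le_iff.1 le_rfl x hx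

theorem dualNorm_mono (h : ∀ᵐ t, u t ≤ v t) : dualNorm E u ≤ dualNorm E v := by
  refine dualNorm_le_iff.2 fun x hx => le_trans ?_ (lintegral_le_dualNorm x hx)
  refine lintegral_mono_ae ?_
  filter_upwards [h] with t ht
  gcongr

theorem dualNorm_const_mul (c : ℝ≥0) (hu : Measurable u) :
    dualNorm E (fun t => c * u t) = c * dualNorm E u := by
  simp only [dualNorm, ENNReal.mul_iSup]
  congr! 4 with x hx
  rw [← lintegral_const_mul _ (x.measurable_enorm_mul hu.coe_nnreal_ennreal)]
  congr! 2 with t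
  push_cast; ring

theorem dualNorm_le_of_ae_tendsto {w : ℕ → unitInterval → ℝ≥0} {K : ℝ≥0∞}
    (hw : ∀ n, Measurable (w n))
    (h : ∀ᵐ t, u t = 0 ∨ Tendsto (fun n => w n t) atTop (𝓝 (u t)))
    (hK : ∀ n, dualNorm E (w n) ≤ K) : dualNorm E u ≤ K := by
  refine dualNorm_le_iff.2 fun x hx => ?_
  refine lintegral_le_of_ae_tendsto (f := fun n t => ‖x t‖ₑ * w n t)
    (fun n => x.measurable_enorm.mul (hw n).coe_nnreal_ennreal) ?_
    (fun n => (lintegral_le_dualNorm x hx).trans (hK n))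
  filter_upwards [h] with t ht
  rcases ht with ht | ht
  · left; simp [ht]
  · right
    exact ENNReal.Tendsto.const_mul (ENNReal.tendsto_coe.2 ht) (.inr (by simp))

namespace IsSymmetricBanachSpace

variable (hE : IsSymmetricBanachSpace E)
include hE

theorem map_smul_coe (c : ℝ≥0) (x : LZero) : E ((c : ℝ) • x) = c * E x := by
  rw [hE.smul, NNReal.abs_eq, ENNReal.ofReal_coe_nnreal]

theorem lintegral_le_mul_dualNorm {x : LZero} (hx : E x < ∞) (hu : Measurable u) :
    ∫⁻ t, ‖x t‖ₑ * u t ≤ E x * dualNorm E u := by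
  rcases eq_or_ne (E x) 0 with h0 | h0
  · have h1 := hE.eq_zero _ h0
    have : ∫⁻ t, ‖x t‖ₑ * u t = 0 := by
      rw [lintegral_eq_zero_iff (x.measurable_enorm_mul hu.coe_nnreal_ennreal)]
      filter_upwards [AEEqFun.coeFn_zero (β := ℝ) (μ := (volume : Measure unitInterval))] with t ht
      rw [h1, ht]; simp
    simp [this]
  obtain ⟨c, hc⟩ : ∃ c : ℝ≥0, E x = c := ⟨_, (ENNReal.coe_toNNReal hx.ne).symm⟩
  rw [hc] at h0 ⊢
  have hc0 : c ≠ 0 := by simpa using h0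
  have h1 := lintegral_le_dualNorm (E := E) (u := u) (((c⁻¹ : ℝ≥0) : ℝ) • x) (by
    rw [hE.map_smul_coe, hc, ← ENNReal.coe_mul, inv_mul_cancel₀ hc0, ENNReal.coe_one])
  calc ∫⁻ t, ‖x t‖ₑ * u t
      = c * ∫⁻ t, ‖(((c⁻¹ : ℝ≥0) : ℝ) • x : LZero) t‖ₑ * u t := by
        rw [← lintegral_const_mul _ (LZero.measurable_enorm_mul _ hu.coe_nnreal_ennreal)]
        refine lintegral_congr_ae ?_
        filter_upwards [AEEqFun.coeFn_smul ((c⁻¹ : ℝ≥0) : ℝ) x] with t ht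
        rw [ht, Pi.smul_apply, enorm_smul, ← mul_assoc, ← mul_assoc]
        congr 1
        rw [show ‖((c⁻¹ : ℝ≥0) : ℝ)‖ₑ = ((c⁻¹ : ℝ≥0) : ℝ≥0∞) by
          simp [enorm_eq_nnnorm], ← ENNReal.coe_mul, mul_inv_cancel₀ hc0]
        simp
    _ ≤ _ := by gcongr

end IsSymmetricBanachSpace

end dualNorm

/-! ### Recovering the norm of `E` from its Köthe dual. -/

namespace IsSymmetricBanachSpace

variable {E : LZero → ℝ≥0∞} (hE : IsSymmetricBanachSpace E)
include hE

theorem isClosed_convex_ball {β : ℝ} (hβ : 1 ≤ β) {C : ℝ≥0} (h : LowerEstimate β C E) (M : ℝ≥0) :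
    IsClosed {a : Lp ℝ 2 (volume : Measure unitInterval) | E a ≤ M} ∧
      Convex ℝ {a : Lp ℝ 2 (volume : Measure unitInterval) | E a ≤ M} := by
  constructor
  · refine IsSeqClosed.isClosed fun a b ha hab => ?_
    obtain ⟨ns, -, hns⟩ := (tendstoInMeasure_of_tendsto_Lp hab).exists_seq_tendsto_ae
    exact hE.le_of_ae_tendsto hβ h (y := fun i => (a (ns i) : LZero)) (fun n => ha _) hns
  · intro a ha b hb s r hs hr hsr
    calc E (s • (a : LZero) + r • (b : LZero))
        ≤ E (s • (a : LZero)) + E (r • (b : LZero)) := hE.add_le _ _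
      _ ≤ ENNReal.ofReal s * M + ENNReal.ofReal r * M := by
          rw [hE.smul, hE.smul, abs_of_nonneg hs, abs_of_nonneg hr]
          gcongr
          · exact ha
          · exact hb
      _ = M := by
          rw [← add_mul, ← ENNReal.ofReal_add hs hr, hsr]; simp

/-- If `‖y‖ > M`, then `y ∈ L²` is strictly separated from the `L²`-closed convex set `{‖·‖ ≤ M}` by
some `φ ∈ L²`. Suitably scaled, `|φ|` lies in the unit ball of `E^×` and violates the hypothesis on
`y`. -/
theorem le_of_forall_lintegral_le_of_bounded {β : ℝ} (hβ : 1 ≤ β) {C : ℝ≥0}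
    (h : LowerEstimate β C E) {y : LZero} {K : ℝ} (hyK : ∀ᵐ t, ‖y t‖ ≤ K) {M : ℝ≥0} (hM : 0 < M)
    (hy : ∀ u : unitInterval → ℝ≥0, Measurable u → dualNorm E u ≤ 1 →
      ∫⁻ t, ‖y t‖ₑ * u t ≤ M) : E y ≤ M := by
  by_contra hcon
  have hyL : y ∈ Lp ℝ 2 (volume : Measure unitInterval) :=
    Lp.mem_Lp_iff_memLp.2 (MemLp.of_bound y.aestronglyMeasurable K hyK)
  obtain ⟨hcl, hcv⟩ := hE.isClosed_convex_ball hβ h M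
  obtain ⟨f, s, hf, hs⟩ := geometric_hahn_banach_closed_point hcv hcl
    (x := (⟨y, hyL⟩ : Lp ℝ 2 (volume : Measure unitInterval))) hcon
  set φ := (InnerProductSpace.toDual ℝ _).symm f with hφ
  have hfφ : ∀ a, f a = ∫ t, a t * φ t := fun a => by
    rw [← InnerProductSpace.toDual_symm_apply (𝕜 := ℝ), L2.inner_def]
    rfl
  have hint : ∀ a : Lp ℝ 2 (volume : Measure unitInterval), Integrable fun t => a t * φ t :=
    fun a => L2.integrable_inner (𝕜 := ℝ) φ a
  have hs0 : 0 < s := by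
    have := hf 0 (by
      change E 0 ≤ M
      rw [hE.map_zero]; exact zero_le)
    simpa using this
  have hφm : Measurable fun t => φ t := AEEqFun.measurable _
  -- Testing the separating functional on `sign(φ) min(|z|, n)`, which is bounded (hence in `L²`)
  -- and in the ball by the lattice property, puts the absolute value inside the integral.
  have hball : ∀ z : LZero, E z ≤ M → ∫⁻ t, ‖z t‖ₑ * ‖φ t‖ₑ ≤ ENNReal.ofReal s := by
    intro z hz
    have hzm : Measurable fun t => z t := z.measurable
    refine lintegral_le_of_ae_tendsto (f := fun n t => ENNReal.ofReal (min |z t| n * |φ t|))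
      (fun n => by fun_prop) (.of_forall fun t => .inr ?_) fun n => ?_
    · refine tendsto_const_nhds.congr' ?_
      obtain ⟨N, hN⟩ := exists_nat_ge |z t|
      filter_upwards [eventually_ge_atTop N] with n hn
      rw [min_eq_left (hN.trans (by exact_mod_cast hn)), ENNReal.ofReal_mul (abs_nonneg _),
        ← Real.enorm_eq_ofReal_abs, ← Real.enorm_eq_ofReal_abs]
    · have hsm : Measurable fun t => Real.sign (φ t) * min |z t| n := by
        refine Measurable.mul ?_ (by fun_prop)
        unfold Real.sign
        exact Measurable.ite (measurableSet_lt hφm measurable_const) measurable_const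
          (Measurable.ite (measurableSet_lt measurable_const hφm) measurable_const measurable_const)
      have hsgn : ∀ r : ℝ, |Real.sign r| ≤ 1 := fun r => by
        rcases Real.sign_apply_eq r with h | h | h <;> simp [h]
      have habs : ∀ t, |Real.sign (φ t) * min |z t| n| ≤ min |z t| n := fun t => by
        rw [abs_mul, abs_of_nonneg (a := min |z t| (n : ℝ)) (by positivity)]
        exact mul_le_of_le_one_left (by positivity) (hsgn _)
      have hmem : MemLp (fun t => Real.sign (φ t) * min |z t| n) 2 volume :=
        MemLp.of_bound hsm.aestronglyMeasurable n
          (.of_forall fun t => (habs t).trans (min_le_right _ _))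
      have ha := hf hmem.toLp ((hE.mono (by
        filter_upwards [hmem.coeFn_toLp] with t ht
        rw [ht]
        exact (habs t).trans (min_le_left _ _))).trans hz)
      have hae : (fun t : unitInterval => (hmem.toLp : Lp ℝ 2 (volume : Measure unitInterval)) t * φ t) =ᵐ[volume] fun t => min |z t| n * |φ t| := by
        filter_upwards [hmem.coeFn_toLp] with t ht
        rw [ht, mul_right_comm, mul_comm, mul_comm (Real.sign _)]
        congr 1
        rcases lt_trichotomy (φ t) 0 with h | h | h
        · rw [Real.sign_of_neg h, abs_of_neg h]; ring
        · simp [h]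
        · rw [Real.sign_of_pos h, abs_of_pos h]; ring
      rw [hfφ, integral_congr_ae hae] at ha
      rw [← ofReal_integral_eq_lintegral_ofReal ((hint _).congr hae)
        (.of_forall fun t => by positivity)]
      exact ENNReal.ofReal_le_ofReal ha.le
  set S : ℝ≥0 := ⟨s, hs0.le⟩ with hS
  have hSs : ENNReal.ofReal s = S := ENNReal.ofReal_eq_coe_nnreal hs0.le
  have hS0 : S ≠ 0 := fun h => hs0.ne' (congrArg NNReal.toReal h)
  have hφn : Measurable fun t => ‖φ t‖₊ := hφm.nnnorm
  have hdual : dualNorm E (fun t => M / S * ‖φ t‖₊) ≤ 1 := by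
    rw [dualNorm_const_mul _ hφn]
    have h1 : dualNorm E (fun t => ‖φ t‖₊) ≤ (S / M : ℝ≥0) := by
      refine dualNorm_le_iff.2 fun z hz => ?_
      have h2 := hball ((M : ℝ) • z) (by
        rw [hE.map_smul_coe]; exact mul_le_of_le_one_right zero_le hz)
      have h3 : ∫⁻ t, ‖((M : ℝ) • z : LZero) t‖ₑ * ‖φ t‖ₑ = M * ∫⁻ t, ‖z t‖ₑ * ‖φ t‖ₑ := by
        rw [← lintegral_const_mul _ (z.measurable_enorm_mul hφm.enorm)]
        refine lintegral_congr_ae ?_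
        filter_upwards [AEEqFun.coeFn_smul (M : ℝ) z] with t ht
        rw [ht, Pi.smul_apply, enorm_smul, mul_assoc]
        simp [enorm_eq_nnnorm]
      rw [h3, hSs] at h2
      rw [ENNReal.coe_div hM.ne', ENNReal.le_div_iff_mul_le (.inl (by simpa using hM.ne'))
        (.inl (by simp)), mul_comm]
      exact h2
    calc _ ≤ ((M / S : ℝ≥0) : ℝ≥0∞) * (S / M : ℝ≥0) := by gcongr
      _ = 1 := by
        rw [← ENNReal.coe_mul, div_mul_div_cancel₀ hS0, div_self hM.ne', ENNReal.coe_one]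
  have h4 := hy _ (hφn.const_mul _) hdual
  have h5 : ∫⁻ t, ‖y t‖ₑ * ‖φ t‖ₑ ≤ S := by
    have h6 : ∫⁻ t, ‖y t‖ₑ * ((M / S * ‖φ t‖₊ : ℝ≥0) : ℝ≥0∞) =
        (M / S : ℝ≥0) * ∫⁻ t, ‖y t‖ₑ * ‖φ t‖ₑ := by
      rw [← lintegral_const_mul _ (y.measurable_enorm_mul hφm.enorm)]
      congr! 2 with t
      rw [ENNReal.coe_mul, mul_left_comm]; rfl
    rw [h6] at h4
    calc ∫⁻ t, ‖y t‖ₑ * ‖φ t‖ₑ = ((S / M : ℝ≥0) : ℝ≥0∞) *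
          ((M / S : ℝ≥0) * ∫⁻ t, ‖y t‖ₑ * ‖φ t‖ₑ) := by
            rw [← mul_assoc, ← ENNReal.coe_mul, div_mul_div_cancel₀ hM.ne', div_self hS0]; simp
      _ ≤ (S / M : ℝ≥0) * M := by gcongr
      _ = S := by rw [← ENNReal.coe_mul, div_mul_cancel₀ _ hM.ne']
  have h7 : ENNReal.ofReal (f ⟨y, hyL⟩) ≤ S := by
    calc ENNReal.ofReal (f ⟨y, hyL⟩) ≤ ‖f ⟨y, hyL⟩‖ₑ := by
          rw [Real.enorm_eq_ofReal_abs]; exact ENNReal.ofReal_le_ofReal (le_abs_self _)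
      _ ≤ ∫⁻ t, ‖y t * φ t‖ₑ := by rw [hfφ]; exact enorm_integral_le_lintegral_enorm _
      _ = ∫⁻ t, ‖y t‖ₑ * ‖φ t‖ₑ := by simp only [enorm_mul]
      _ ≤ S := h5
  rw [← hSs, ENNReal.ofReal_le_ofReal_iff hs0.le] at h7
  exact absurd h7 (not_le.2 hs)

/-- `‖y‖_E ≤ ‖y‖_{E^{××}}`. -/
theorem le_of_forall_lintegral_le {β : ℝ} (hβ : 1 ≤ β) {C : ℝ≥0}
    (h : LowerEstimate β C E) {y : LZero} {M : ℝ≥0∞}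
    (hy : ∀ u : unitInterval → ℝ≥0, Measurable u → dualNorm E u ≤ 1 →
      ∫⁻ t, ‖y t‖ₑ * u t ≤ M) : E y ≤ M := by
  rcases eq_or_ne M ∞ with rfl | hM
  · exact le_top
  refine ENNReal.le_of_forall_pos_le_add fun ε hε _ => ?_
  have hme : ∀ n : ℕ, Measurable fun t => min ‖y t‖₊ n :=
    fun n => y.measurable_nnnorm.min measurable_const
  have hc := ae_all_iff.2 fun n => coeFn_nnClass _ (hme n)
  rw [← hE.congr_nnClass y]
  refine hE.le_of_ae_tendsto hβ h (y := fun n => nnClass _ (hme n)) (fun n => ?_) ?_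
  · have hMe : M + ε = ((M.toNNReal + ε : ℝ≥0) : ℝ≥0∞) := by
      rw [ENNReal.coe_add, ENNReal.coe_toNNReal hM]
    rw [hMe]
    refine hE.le_of_forall_lintegral_le_of_bounded hβ h (K := n) ?_ (by positivity) ?_
    · filter_upwards [hc] with t ht
      rw [ht, Real.norm_eq_abs, NNReal.abs_eq]
      exact_mod_cast min_le_right _ _
    · intro u hu hu1
      rw [← hMe]
      refine le_trans (lintegral_mono_ae ?_) ((hy u hu hu1).trans le_self_add)
      filter_upwards [hc] with t ht
      rw [ht]
      gcongr
      rw [enorm_eq_nnnorm, enorm_eq_nnnorm, NNReal.nnnorm_eq]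
      exact_mod_cast min_le_left _ _
  · filter_upwards [hc, coeFn_nnClass _ y.measurable_nnnorm] with t ht h1
    simp only [ht, h1]
    refine tendsto_const_nhds.congr' ?_
    obtain ⟨N, hN⟩ := exists_nat_ge ‖y t‖₊
    filter_upwards [eventually_ge_atTop N] with n hn
    rw [min_eq_left (hN.trans (by exact_mod_cast hn))]

end IsSymmetricBanachSpace

/-! ### Convexity of `E^×`, and the norm of `F` in terms of squares. -/

/-- These are the extremal weights in Hölder's inequality. The first relation is only `≤` because
all weights are `0` when every `a i` vanishes. -/
theorem sum_rpow_weights {ι : Type*} (s : Finset ι) (a : ι → ℝ≥0) {β q : ℝ}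
    (hq : β.HolderConjugate q) :
    ∑ i ∈ s, (a i ^ (q - 1) / (∑ j ∈ s, a j ^ q) ^ (1 / β)) ^ β ≤ 1 ∧
      ∑ i ∈ s, a i ^ (q - 1) / (∑ j ∈ s, a j ^ q) ^ (1 / β) * a i =
        (∑ j ∈ s, a j ^ q) ^ (1 / q) := by
  set S := ∑ j ∈ s, a j ^ q with hS
  have hβ := hq.pos
  have hq0 := hq.symm.pos
  constructor
  · have : ∀ i, (a i ^ (q - 1) / S ^ (1 / β)) ^ β = a i ^ q / S := fun i => by
      rw [NNReal.div_rpow, ← NNReal.rpow_mul, ← NNReal.rpow_mul, one_div_mul_cancel hβ.ne',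
        NNReal.rpow_one, hq.symm.sub_one_mul_conj]
    simp only [this, ← Finset.sum_div, ← hS]
    exact div_self_le_one S
  · have : ∀ i, a i ^ (q - 1) / S ^ (1 / β) * a i = a i ^ q / S ^ (1 / β) := fun i => by
      rw [div_mul_eq_mul_div]
      congr 1
      rcases eq_or_ne (a i) 0 with h0 | h0
      · simp [h0, hq0.ne']
      · conv_lhs => rw [← NNReal.rpow_one (a i), ← NNReal.rpow_mul, one_mul]
        rw [← NNReal.rpow_add h0]; congr 1; ring
    simp only [this, ← Finset.sum_div, ← hS]
    rcases eq_or_ne S 0 with h0 | h0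
    · rw [h0, zero_div, NNReal.zero_rpow]
      exact (one_div_pos.2 hq0).ne'
    · rw [div_eq_iff (NNReal.rpow_pos (pos_iff_ne_zero.2 h0)).ne', ← NNReal.rpow_add h0]
      have : 1 / q + 1 / β = 1 := by
        have := hq.inv_add_inv_eq_one
        rw [one_div, one_div, add_comm]; exact this
      rw [this, NNReal.rpow_one]

/-- The functional `sup {∫ v u² : ‖u‖_{E^×} ≤ 1}` on nonnegative functions. -/
noncomputable def sqDualNorm (E : LZero → ℝ≥0∞) (v : unitInterval → ℝ≥0) : ℝ≥0∞ :=
  ⨆ (u : unitInterval → ℝ≥0) (_ : Measurable u) (_ : dualNorm E u ≤ 1),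
    ∫⁻ t, (v t : ℝ≥0∞) * (u t : ℝ≥0∞) ^ 2

section sqDualNorm

variable {E : LZero → ℝ≥0∞} {v w : unitInterval → ℝ≥0}

theorem sqDualNorm_le_iff {K : ℝ≥0∞} :
    sqDualNorm E v ≤ K ↔ ∀ u : unitInterval → ℝ≥0, Measurable u → dualNorm E u ≤ 1 →
      ∫⁻ t, (v t : ℝ≥0∞) * (u t : ℝ≥0∞) ^ 2 ≤ K := by
  simp only [sqDualNorm, iSup_le_iff]

theorem sqDualNorm_mono (h : ∀ᵐ t, v t ≤ w t) : sqDualNorm E v ≤ sqDualNorm E w := by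
  refine sqDualNorm_le_iff.2 fun u hu hu1 => le_trans ?_ (sqDualNorm_le_iff.1 le_rfl u hu hu1)
  refine lintegral_mono_ae ?_
  filter_upwards [h] with t ht
  gcongr

theorem sqDualNorm_add_le (hv : Measurable v) :
    sqDualNorm E (fun t => v t + w t) ≤ sqDualNorm E v + sqDualNorm E w := by
  refine sqDualNorm_le_iff.2 fun u hu hu1 => ?_
  simp only [ENNReal.coe_add, add_mul]
  rw [lintegral_add_left (by fun_prop)]
  exact add_le_add (sqDualNorm_le_iff.1 le_rfl u hu hu1) (sqDualNorm_le_iff.1 le_rfl u hu hu1)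

/-- Substitute `h = u²`: the unit ball of `(E^×)^{(1/2)}` consists, up to sign, of squares of
elements of the unit ball of `E^×`. -/
theorem kotheDual_powerSpace_eq (f : LZero) :
    kotheDual (powerSpace (1 / 2) (kotheDual E)) f = sqDualNorm E fun t => ‖f t‖₊ := by
  have hiff : ∀ h : LZero, powerSpace (1 / 2) (kotheDual E) h ≤ 1 ↔
      dualNorm E (fun t => ‖absPow (1 / 2) h t‖₊) ≤ 1 := fun h => by
    rw [← kotheDual_eq_dualNorm, powerSpace]
    conv_lhs => rw [← ENNReal.one_rpow (1 / (1 / 2) : ℝ)]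
    exact ENNReal.rpow_le_rpow_iff (by norm_num)
  rw [kotheDual_eq_dualNorm]
  refine le_antisymm (dualNorm_le_iff.2 fun h hh => ?_) (sqDualNorm_le_iff.2 fun u hu hu1 => ?_)
  · refine le_trans (lintegral_mono_ae ?_)
      (sqDualNorm_le_iff.1 le_rfl _ (LZero.measurable_nnnorm _) ((hiff h).1 hh))
    filter_upwards [coeFn_absPow (1 / 2) h] with t ht
    rw [ht, mul_comm]
    gcongr
    rw [enorm_eq_nnnorm]
    refine le_of_eq ?_
    norm_cast
    rw [← NNReal.coe_inj]
    push_cast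
    rw [Real.norm_eq_abs, Real.norm_of_nonneg (by positivity), ← Real.sqrt_eq_rpow,
      Real.sq_sqrt (abs_nonneg _)]
  · have hm : Measurable fun t => u t ^ 2 := by fun_prop
    refine le_trans (lintegral_mono_ae ?_) (dualNorm_le_iff.1 le_rfl (nnClass _ hm) ?_)
    · filter_upwards [coeFn_nnClass _ hm] with t ht
      rw [ht, mul_comm]
      gcongr
      rw [enorm_eq_nnnorm, NNReal.nnnorm_eq]
      push_cast; rfl
    · rw [hiff]
      refine (dualNorm_mono ?_).trans hu1
      filter_upwards [coeFn_nnClass _ hm, coeFn_absPow (1 / 2) (nnClass _ hm)] with t h1 h2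
      rw [h2, h1, ← NNReal.coe_le_coe, coe_nnnorm, NNReal.abs_eq,
        Real.norm_of_nonneg (by positivity), ← Real.sqrt_eq_rpow]
      push_cast
      rw [Real.sqrt_sq (by positivity)]

end sqDualNorm

namespace IsSymmetricBanachSpace

variable {E : LZero → ℝ≥0∞} (hE : IsSymmetricBanachSpace E)
include hE

/-- Duality turns the lower `β`-estimate of `E` into `q`-convexity of `E^×`: the extremal weights
linearize the `ℓ^q`-norm pointwise, and the functions `w_i |x|` obey the lower estimate against `x`.
-/
theorem dualNorm_rpow_sum_le {β q : ℝ} (hq : β.HolderConjugate q) {C : ℝ≥0}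
    (h : LowerEstimate β C E) {ι : Type*} [Fintype ι] {u : ι → unitInterval → ℝ≥0}
    (hu : ∀ i, Measurable (u i)) :
    dualNorm E (fun t => (∑ i, u i t ^ q) ^ (1 / q)) ≤
      C * (∑ i, dualNorm E (u i) ^ q) ^ (1 / q) := by
  have hβ := hq.pos
  refine dualNorm_le_iff.2 fun x hx => ?_
  have hx' : E x < ∞ := hx.trans_lt ENNReal.one_lt_top
  set w : ι → unitInterval → ℝ≥0 :=
    fun i t => u i t ^ (q - 1) / (∑ j, u j t ^ q) ^ (1 / β) with hw
  have hwt := fun t => sum_rpow_weights Finset.univ (fun i => u i t) hq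
  have hxm := x.measurable_nnnorm
  have hwm : ∀ i, Measurable fun t => w i t * ‖x t‖₊ := fun i => by
    have : Measurable (w i) := by fun_prop
    exact this.mul hxm
  set y : ι → LZero := fun i => nnClass _ (hwm i) with hy
  have hyc := ae_all_iff.2 fun i => coeFn_nnClass _ (hwm i)
  have hyx : ∀ᵐ t, ∑ i, |y i t| ^ β ≤ |x t| ^ β := by
    filter_upwards [hyc] with t ht
    have : ∀ i, |y i t| ^ β = ((w i t ^ β * ‖x t‖₊ ^ β : ℝ≥0) : ℝ) := fun i => by
      rw [hy, ht, NNReal.abs_eq, ← NNReal.mul_rpow, NNReal.coe_rpow]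
    simp only [this]
    rw [← NNReal.coe_sum, ← Finset.sum_mul]
    calc ((((∑ i, w i t ^ β) * ‖x t‖₊ ^ β : ℝ≥0)) : ℝ) ≤ ((1 * ‖x t‖₊ ^ β : ℝ≥0) : ℝ) := by
          refine NNReal.coe_le_coe.2 ?_
          gcongr
          exact (hwt t).1
      _ = _ := by simp
  set e := Fintype.equivFin ι
  have hsum : ∑ i, E (y i) ^ β ≤ (C * E x) ^ β := by
    have h1 := h (Fintype.card ι) (fun k => y (e.symm k)) x hx' (by
      filter_upwards [hyx] with t ht
      rwa [Equiv.sum_comp e.symm fun i => |y i t| ^ β])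
    rwa [Equiv.sum_comp e.symm fun i => E (y i) ^ β] at h1
  have hyfin : ∀ i, E (y i) < ∞ := fun i => by
    have h1 : E (y i) ^ β ≤ (C * E x) ^ β :=
      (Finset.single_le_sum (f := fun i => E (y i) ^ β) (fun _ _ => zero_le)
        (Finset.mem_univ i)).trans hsum
    rw [ENNReal.rpow_le_rpow_iff hβ] at h1
    exact h1.trans_lt (ENNReal.mul_lt_top (by simp) hx')
  calc ∫⁻ t, ‖x t‖ₑ * (((∑ i, u i t ^ q) ^ (1 / q) : ℝ≥0) : ℝ≥0∞)
      = ∫⁻ t, ∑ i, ‖y i t‖ₑ * u i t := by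
        refine lintegral_congr_ae ?_
        filter_upwards [hyc] with t ht
        simp only [hy, ht]
        rw [← (hwt t).2]
        simp only [enorm_eq_nnnorm, NNReal.nnnorm_eq]
        norm_cast
        rw [Finset.mul_sum]
        exact Finset.sum_congr rfl fun i _ => by simp only [hw]; ring
    _ = ∑ i, ∫⁻ t, ‖y i t‖ₑ * u i t :=
        lintegral_finsetSum _ fun i _ => (y i).measurable_enorm_mul (hu i).coe_nnreal_ennreal
    _ ≤ ∑ i, E (y i) * dualNorm E (u i) :=
        Finset.sum_le_sum fun i _ => hE.lintegral_le_mul_dualNorm (hyfin i) (hu i)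
    _ ≤ (∑ i, E (y i) ^ β) ^ (1 / β) * (∑ i, dualNorm E (u i) ^ q) ^ (1 / q) :=
        ENNReal.inner_le_Lp_mul_Lq _ _ _ hq
    _ ≤ ((C * 1) ^ β) ^ (1 / β) * (∑ i, dualNorm E (u i) ^ q) ^ (1 / q) := by
        gcongr
        exact hsum.trans (by gcongr)
    _ = _ := by
        rw [← ENNReal.rpow_mul, mul_one_div_cancel hβ.ne', ENNReal.rpow_one, mul_one]

theorem ae_eq_zero_of_dualNorm_eq_zero {u : unitInterval → ℝ≥0} (hu : Measurable u)
    (h : dualNorm E u = 0) : ∀ᵐ t, u t = 0 := by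
  have h1 := hE.lintegral_le_mul_dualNorm hE.map_one_lt_top hu
  rw [h, mul_zero] at h1
  have h2 := (lintegral_eq_zero_iff
    (LZero.measurable_enorm_mul 1 hu.coe_nnreal_ennreal)).1 (le_antisymm h1 zero_le)
  filter_upwards [h2, LZero.coeFn_one] with t h3 h4
  simpa [h4] using h3

theorem lintegral_mul_sq_le {v u : unitInterval → ℝ≥0} (hu : Measurable u)
    (hfin : dualNorm E u ≠ ∞) :
    ∫⁻ t, (v t : ℝ≥0∞) * (u t : ℝ≥0∞) ^ 2 ≤ sqDualNorm E v * dualNorm E u ^ 2 := by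
  rcases eq_or_ne (dualNorm E u) 0 with h0 | h0
  · have h1 := hE.ae_eq_zero_of_dualNorm_eq_zero hu h0
    have : ∫⁻ t, (v t : ℝ≥0∞) * (u t : ℝ≥0∞) ^ 2 = ∫⁻ _ : unitInterval, 0 := by
      refine lintegral_congr_ae ?_
      filter_upwards [h1] with t ht
      simp [ht]
    simp [this]
  obtain ⟨c, hc⟩ : ∃ c : ℝ≥0, dualNorm E u = c := ⟨_, (ENNReal.coe_toNNReal hfin).symm⟩
  rw [hc] at h0 ⊢
  have hc0 : c ≠ 0 := by simpa using h0
  have h1 := sqDualNorm_le_iff.1 (le_refl (sqDualNorm E v)) (fun t => c⁻¹ * u t) (hu.const_mul _)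
    (by rw [dualNorm_const_mul _ hu, hc, ← ENNReal.coe_mul, inv_mul_cancel₀ hc0, ENNReal.coe_one])
  calc ∫⁻ t, (v t : ℝ≥0∞) * (u t : ℝ≥0∞) ^ 2
      = ∫⁻ t, ((v t : ℝ≥0∞) * ((c⁻¹ * u t : ℝ≥0) : ℝ≥0∞) ^ 2) * ((c ^ 2 : ℝ≥0) : ℝ≥0∞) := by
        refine lintegral_congr fun t => ?_
        norm_cast
        field_simp
    _ = (∫⁻ t, (v t : ℝ≥0∞) * ((c⁻¹ * u t : ℝ≥0) : ℝ≥0∞) ^ 2) * ((c ^ 2 : ℝ≥0) : ℝ≥0∞) :=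
        lintegral_mul_const' _ _ (by simp)
    _ ≤ _ := by push_cast; gcongr; push_cast at h1; exact h1

/-- From `s 1_{|x|>s} ≤ |x|` and `volume_le_of_convex`, the unit ball of `E` is bounded in weak
`L^α`, hence in `L¹` as `α > 1`. -/
theorem dualNorm_one_lt_top {α : ℝ} (hα : 1 < α) (h : IsLatticeConvex α E) :
    dualNorm E 1 < ∞ := by
  have hα0 : 0 < α := by linarith
  obtain ⟨K, hK⟩ := hE.volume_le_of_convex hα0 h
  refine lt_of_le_of_lt (b := 1 + (K : ℝ≥0∞) * ENNReal.ofReal (1 / (α - 1)))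
    (dualNorm_le_iff.2 fun x hx => ?_)
    (ENNReal.add_lt_top.2 ⟨by simp, ENNReal.mul_lt_top (by simp) (by simp)⟩)
  simp only [Pi.one_apply, ENNReal.coe_one, mul_one]
  refine lintegral_le_of_weak_type x.measurable_nnnorm hα fun s hs => ?_
  have hs0 : 0 < s := by linarith
  have hA : MeasurableSet {t | s < ‖x t‖₊} :=
    measurableSet_lt measurable_const x.measurable_nnnorm.coe_nnreal_real
  refine (hK _ hA).trans ?_
  gcongr
  obtain ⟨c, rfl⟩ : ∃ c : ℝ≥0, s = c := ⟨⟨s, hs0.le⟩, rfl⟩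
  have hc0 : c ≠ 0 := by rintro rfl; simp at hs0
  have h1 : c * E (indClass _ hA) ≤ 1 := by
    rw [← hE.map_smul_coe]
    refine (hE.mono ?_).trans hx
    filter_upwards [AEEqFun.coeFn_smul (c : ℝ) (indClass _ hA), coeFn_indClass _ hA] with t h1 h2
    rw [h1, Pi.smul_apply, h2]
    by_cases h : t ∈ {t | (c : ℝ) < ‖x t‖₊}
    · rw [Set.indicator_of_mem h]
      have h3 : (c : ℝ) < |x t| := h
      simpa using h3.le
    · rw [Set.indicator_of_notMem h]
      simp
  have h2 : E (indClass _ hA) ≤ (c : ℝ≥0∞)⁻¹ := by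
    rw [ENNReal.le_inv_iff_mul_le, mul_comm]; exact h1
  calc E (indClass _ hA) ^ α ≤ ((c : ℝ≥0∞)⁻¹) ^ α := ENNReal.rpow_le_rpow h2 hα0.le
    _ = ENNReal.ofReal ((c : ℝ) ^ (-α)) := by
      rw [← NNReal.coe_rpow, ENNReal.ofReal_coe_nnreal, ← ENNReal.coe_inv hc0,
        ← ENNReal.coe_rpow_of_nonneg _ hα0.le, NNReal.rpow_neg, NNReal.inv_rpow]

/-- On `A = {u > c}`, with `u` in the unit ball of `E^×`, one has `c m(A) ≤ ‖1_A‖ ≤ (K m(A))^{1/β}`.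
So this ball is bounded in weak `L^{β/(β-1)}`, whose exponent exceeds 2, hence in `L²`. -/
theorem sqDualNorm_one_lt_top {β : ℝ} (hβ₁ : 1 < β) (hβ₂ : β < 2) {C : ℝ≥0}
    (h : LowerEstimate β C E) : sqDualNorm E 1 < ∞ := by
  have hβ0 : 0 < β := by linarith
  have hβ1 : 0 < β - 1 := by linarith
  obtain ⟨K, hK⟩ := hE.indClass_rpow_le hβ0 h
  -- Half the conjugate exponent of `β`, because the weak-type bound is applied to `u²`; `r > 1` is
  -- exactly `β < 2`.
  set r : ℝ := β / (β - 1) / 2 with hr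
  have hr1 : 1 < r := by rw [hr, div_div, lt_div_iff₀ (by positivity)]; linarith
  refine lt_of_le_of_lt (b := 1 + ((K : ℝ≥0∞) ^ (1 / (β - 1))) * ENNReal.ofReal (1 / (r - 1)))
    (sqDualNorm_le_iff.2 fun u hu hu1 => ?_)
    (ENNReal.add_lt_top.2 ⟨by simp, ENNReal.mul_lt_top
      (ENNReal.rpow_lt_top_of_nonneg (by positivity) (by simp)) (by simp)⟩)
  have hm : Measurable fun t => u t ^ 2 := by fun_prop
  calc _ = ∫⁻ t, ((u t ^ 2 : ℝ≥0) : ℝ≥0∞) := by simp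
    _ ≤ _ := lintegral_le_of_weak_type hm hr1 fun s hs => ?_
  have hs0 : 0 < s := by linarith
  obtain ⟨c, rfl⟩ : ∃ c : ℝ≥0, s = (c : ℝ) ^ 2 :=
    ⟨⟨√s, Real.sqrt_nonneg _⟩, (Real.sq_sqrt hs0.le).symm⟩
  have hc0 : c ≠ 0 := by rintro rfl; simp at hs0
  have hA : MeasurableSet {t | (c : ℝ) ^ 2 < (u t ^ 2 : ℝ≥0)} :=
    measurableSet_lt measurable_const hm.coe_nnreal_real
  set A := {t | (c : ℝ) ^ 2 < (u t ^ 2 : ℝ≥0)} with hAdef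
  have hcA : ∀ t ∈ A, c ≤ u t := fun t ht => by
    have h1 : (c : ℝ) ^ 2 < (u t ^ 2 : ℝ≥0) := ht
    rw [NNReal.coe_pow] at h1
    exact_mod_cast (lt_of_pow_lt_pow_left₀ 2 (by positivity) h1).le
  have hvol : volume A ≠ ∞ := measure_ne_top _ _
  rcases eq_or_ne (volume A) 0 with hv0 | hv0
  · simp [hv0]
  have hAfin : E (indClass A hA) < ∞ := by
    by_contra hcon
    rw [not_lt, top_le_iff] at hcon
    have h2 := hK A hA
    rw [hcon, ENNReal.top_rpow_of_pos hβ0, top_le_iff] at h2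
    exact ENNReal.mul_ne_top (by simp) hvol h2
  have h1 : (c : ℝ≥0∞) * volume A ≤ E (indClass A hA) := by
    calc (c : ℝ≥0∞) * volume A = ∫⁻ t in A, (c : ℝ≥0∞) := by simp
      _ = ∫⁻ t, A.indicator (fun _ => (c : ℝ≥0∞)) t := (lintegral_indicator hA _).symm
      _ ≤ ∫⁻ t, ‖indClass A hA t‖ₑ * u t := by
        refine lintegral_mono_ae ?_
        filter_upwards [coeFn_indClass A hA] with t ht
        rw [ht]
        by_cases h : t ∈ A
        · rw [Set.indicator_of_mem h, Set.indicator_of_mem h]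
          simpa using hcA t h
        · simp [Set.indicator_of_notMem h]
      _ ≤ E (indClass A hA) * dualNorm E u := hE.lintegral_le_mul_dualNorm hAfin hu
      _ ≤ E (indClass A hA) * 1 := by gcongr
      _ = _ := mul_one _
  have h2 : ((c : ℝ≥0∞) * volume A) ^ β ≤ K * volume A :=
    (ENNReal.rpow_le_rpow h1 hβ0.le).trans (hK A hA)
  obtain ⟨a, ha⟩ : ∃ a : ℝ≥0, volume A = a := ⟨_, (ENNReal.coe_toNNReal hvol).symm⟩
  rw [ha] at h2 hv0 ⊢
  have ha0 : a ≠ 0 := by simpa using hv0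
  have hc2 : ((c : ℝ) ^ 2) ^ (-r) = ((c ^ (-(β / (β - 1))) : ℝ≥0) : ℝ) := by
    rw [← Real.rpow_natCast, ← Real.rpow_mul (by positivity), NNReal.coe_rpow]
    congr 1
    rw [hr]; push_cast; ring
  rw [hc2, ENNReal.ofReal_coe_nnreal]
  rw [← ENNReal.coe_mul, ← ENNReal.coe_mul, ← ENNReal.coe_rpow_of_nonneg _ hβ0.le,
    ENNReal.coe_le_coe] at h2
  rw [← ENNReal.coe_rpow_of_nonneg _ (by positivity), ← ENNReal.coe_mul, ENNReal.coe_le_coe]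
  have h3 : c ^ β * a ^ (β - 1) ≤ K := by
    rw [NNReal.mul_rpow] at h2
    have h4 : a ^ β = a ^ (β - 1) * a := by
      conv_rhs => rw [← NNReal.rpow_one a, ← NNReal.rpow_mul, one_mul]
      rw [← NNReal.rpow_add ha0]; congr 1; ring
    rw [h4, ← mul_assoc] at h2
    exact le_of_mul_le_mul_right h2 (pos_iff_ne_zero.2 ha0)
  have h5 := NNReal.rpow_le_rpow h3 (z := 1 / (β - 1)) (by positivity)
  rw [NNReal.mul_rpow, ← NNReal.rpow_mul, ← NNReal.rpow_mul, mul_one_div_cancel hβ1.ne',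
    NNReal.rpow_one, mul_one_div] at h5
  rw [NNReal.rpow_neg, ← div_eq_mul_inv,
    le_div_iff₀ (NNReal.rpow_pos (pos_iff_ne_zero.2 hc0)), mul_comm]
  exact h5

/-- The inclusion `F ⊙ E^× ⊆ E`. -/
theorem le_mul_of_product {β : ℝ} (hβ : 1 ≤ β) {C : ℝ≥0} (h : LowerEstimate β C E)
    {f g : LZero} (hg : kotheDual E g < ∞) :
    E (f * g) ≤ kotheDual (powerSpace (1 / 2) (kotheDual E)) f * kotheDual E g := by
  rw [kotheDual_powerSpace_eq, kotheDual_eq_dualNorm] at *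
  refine hE.le_of_forall_lintegral_le hβ h fun u hu hu1 => ?_
  set Φ := sqDualNorm E fun t => ‖f t‖₊
  set Γ := dualNorm E fun t => ‖g t‖₊
  have hfm := f.measurable_nnnorm
  have hgm := g.measurable_nnnorm
  have hsq : ∀ a : ℝ≥0, (NNReal.sqrt a : ℝ≥0∞) * (NNReal.sqrt a : ℝ≥0∞) = a := fun a => by
    rw [← ENNReal.coe_mul, NNReal.mul_self_sqrt]
  -- Cauchy–Schwarz with `|f|` split evenly: both factors become integrals of `|f|` against a
  -- square, which the norm of `F` controls.
  have hcs := ENNReal.lintegral_mul_le_Lp_mul_Lq volume Real.HolderConjugate.two_two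
    (f := fun t => (NNReal.sqrt ‖f t‖₊ * ‖g t‖₊ : ℝ≥0)) (g := fun t => (NNReal.sqrt ‖f t‖₊ * u t : ℝ≥0))
    (by fun_prop) (by fun_prop)
  have hsq2 : ∀ a b : ℝ≥0, ((NNReal.sqrt a * b : ℝ≥0) : ℝ≥0∞) ^ (2 : ℝ) = a * (b : ℝ≥0∞) ^ 2 :=
    fun a b => by
      rw [ENNReal.rpow_two]
      norm_cast
      rw [mul_pow, NNReal.sq_sqrt]
  simp only [hsq2] at hcs
  calc ∫⁻ t, ‖(f * g : LZero) t‖ₑ * u t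
      = ∫⁻ t, ((fun t => ((NNReal.sqrt ‖f t‖₊ * ‖g t‖₊ : ℝ≥0) : ℝ≥0∞)) *
          fun t => ((NNReal.sqrt ‖f t‖₊ * u t : ℝ≥0) : ℝ≥0∞)) t := by
        refine lintegral_congr_ae ?_
        filter_upwards [AEEqFun.coeFn_mul f g] with t ht
        rw [ht, Pi.mul_apply, Pi.mul_apply, enorm_mul, ENNReal.coe_mul, ENNReal.coe_mul,
          enorm_eq_nnnorm, ← hsq ‖f t‖₊, enorm_eq_nnnorm]
        ring
    _ ≤ _ := hcs
    _ ≤ (Φ * Γ ^ 2) ^ (1 / 2 : ℝ) * (Φ * 1) ^ (1 / 2 : ℝ) := by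
        gcongr
        · exact hE.lintegral_mul_sq_le hgm hg.ne
        · rw [mul_one]; exact sqDualNorm_le_iff.1 le_rfl u hu hu1
    _ = Φ * Γ := by
        rw [mul_one, ENNReal.mul_rpow_of_nonneg _ _ (by norm_num), ← ENNReal.rpow_natCast,
          ← ENNReal.rpow_mul, mul_right_comm, ← ENNReal.rpow_add_of_nonneg _ _ (by norm_num)
          (by norm_num)]
        norm_num

end IsSymmetricBanachSpace

/-! ### The 2-convex hull of the unit ball of `E^×`. -/

/-- Square roots of finite sums `∑ u_i²` with `∑ ‖u_i‖²_{E^×} ≤ 1`. -/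
def SqHull (E : LZero → ℝ≥0∞) (g : unitInterval → ℝ≥0) : Prop :=
  ∃ (ι : Type) (_ : Fintype ι) (u : ι → unitInterval → ℝ≥0), (∀ i, Measurable (u i)) ∧
    ∑ i, dualNorm E (u i) ^ 2 ≤ 1 ∧ g = fun t => NNReal.sqrt (∑ i, u i t ^ 2)

namespace SqHull

variable {E : LZero → ℝ≥0∞} {g h : unitInterval → ℝ≥0}

theorem of_dualNorm_le_one (hg : Measurable g) (h : dualNorm E g ≤ 1) : SqHull E g := by
  refine ⟨Unit, inferInstance, fun _ => g, fun _ => hg, ?_, ?_⟩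
  · simpa using pow_le_one₀ zero_le h
  · simp

theorem measurable (hg : SqHull E g) : Measurable g := by
  obtain ⟨ι, _, u, hu, -, rfl⟩ := hg
  exact NNReal.continuous_sqrt.measurable.comp (Finset.measurable_sum _ fun i _ => (hu i).pow_const 2)

/-- Concatenating the two families shows that the squares of hull elements form a convex set. The
unit ball of `E^×` itself need not have this property, since its 2-convexity may cost a constant;
hence the hull. -/
theorem combine (hg : SqHull E g) (hh : SqHull E h) {a b : ℝ≥0} (hab : a ^ 2 + b ^ 2 ≤ 1) :
    SqHull E fun t => NNReal.sqrt ((a * g t) ^ 2 + (b * h t) ^ 2) := by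
  obtain ⟨ι, _, u, hu, hu1, rfl⟩ := hg
  obtain ⟨κ, _, v, hv, hv1, rfl⟩ := hh
  refine ⟨ι ⊕ κ, inferInstance,
    Sum.elim (fun i t => a * u i t) (fun j t => b * v j t), ?_, ?_, ?_⟩
  · rintro (i | j)
    · exact (hu i).const_mul a
    · exact (hv j).const_mul b
  · simp only [Fintype.sum_sum_type, Sum.elim_inl, Sum.elim_inr, dualNorm_const_mul _ (hu _),
      dualNorm_const_mul _ (hv _), mul_pow, ← Finset.mul_sum]
    calc _ ≤ (a : ℝ≥0∞) ^ 2 * 1 + (b : ℝ≥0∞) ^ 2 * 1 := by gcongr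
      _ ≤ 1 := by rw [mul_one, mul_one]; exact_mod_cast hab
  · funext t
    simp only [Fintype.sum_sum_type, Sum.elim_inl, Sum.elim_inr, mul_pow, ← Finset.mul_sum,
      NNReal.sq_sqrt]

theorem dualNorm_le (hE : IsSymmetricBanachSpace E) {C : ℝ≥0} (hC : LowerEstimate 2 C E)
    (hg : SqHull E g) : dualNorm E g ≤ C := by
  obtain ⟨ι, _, u, hu, hu1, rfl⟩ := hg
  have h1 := hE.dualNorm_rpow_sum_le Real.HolderConjugate.two_two hC hu
  simp only [NNReal.rpow_two, ENNReal.rpow_two, ← NNReal.sqrt_eq_rpow] at h1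
  calc _ ≤ C * (∑ i, dualNorm E (u i) ^ 2) ^ (1 / 2 : ℝ) := h1
    _ ≤ C * 1 ^ (1 / 2 : ℝ) := by gcongr
    _ = C := by simp

end SqHull

/-- Quantitative strict concavity of the square root. With `D = m - (g+h)/2`, one has `(g-h)²/4 = D
(m + (g+h)/2) ≤ (3/2) D (g+h)`; then the arithmetic–geometric mean inequality with parameter `δ`
makes the bound linear, ready for integration. -/
theorem abs_sub_le_of_midpoint {g h m δ : ℝ} (hg : 0 ≤ g) (hh : 0 ≤ h) (hm : 0 ≤ m)
    (hδ : 0 < δ) (hmid : m ^ 2 = (g ^ 2 + h ^ 2) / 2) :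
    |g - h| ≤ δ * (g + h) + 3 / (2 * δ) * (m - (g + h) / 2) := by
  have hD : 0 ≤ m - (g + h) / 2 := by nlinarith [sq_nonneg (g - h)]
  have hmle : m ≤ g + h := by nlinarith [mul_nonneg hg hh]
  have h1 : (g - h) ^ 2 ≤ 6 * (g + h) * (m - (g + h) / 2) := by
    nlinarith [mul_nonneg (sub_nonneg.2 hmle) hD]
  have h2 : 0 ≤ δ * (g + h) + 3 / (2 * δ) * (m - (g + h) / 2) := by positivity
  refine abs_le_of_sq_le_sq ?_ h2
  have h3 : 6 * (g + h) * (m - (g + h) / 2) =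
      4 * (δ * (g + h)) * (3 / (2 * δ) * (m - (g + h) / 2)) := by field_simp; ring
  nlinarith [sq_nonneg (δ * (g + h) - 3 / (2 * δ) * (m - (g + h) / 2))]

/-! ### Maximizing `∫ |x| g` over the hull. -/

section Maximizer

variable {E : LZero → ℝ≥0∞} (x : LZero)

/-- The supremum of `∫ |x| g` over the hull. -/
noncomputable def hullSup (E : LZero → ℝ≥0∞) (x : LZero) : ℝ≥0∞ :=
  ⨆ (g : unitInterval → ℝ≥0) (_ : SqHull E g), ∫⁻ t, ‖x t‖ₑ * g t

variable {x}

theorem le_hullSup {g : unitInterval → ℝ≥0} (hg : SqHull E g) :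
    ∫⁻ t, ‖x t‖ₑ * g t ≤ hullSup E x :=
  le_iSup₂ (f := fun (g : unitInterval → ℝ≥0) (_ : SqHull E g) => ∫⁻ t, ‖x t‖ₑ * g t) g hg

theorem hullSup_le (hE : IsSymmetricBanachSpace E) {C : ℝ≥0} (hC : LowerEstimate 2 C E)
    (hx : E x < ∞) : hullSup E x ≤ E x * C :=
  iSup₂_le fun _ hg => (hE.lintegral_le_mul_dualNorm hx hg.measurable).trans
    (by gcongr; exact hg.dualNorm_le hE hC)

theorem exists_hullSup_le_add (hS : hullSup E x ≠ ∞) {ε : ℝ≥0∞} (hε : ε ≠ 0) :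
    ∃ g, SqHull E g ∧ hullSup E x ≤ (∫⁻ t, ‖x t‖ₑ * g t) + ε := by
  rcases eq_or_ne (hullSup E x) 0 with h0 | h0
  · refine ⟨fun _ => 0, SqHull.of_dualNorm_le_one measurable_const ?_, by simp [h0]⟩
    simp [dualNorm]
  · have h1 := ENNReal.sub_lt_self hS h0 hε
    conv_rhs at h1 => rw [hullSup]
    simp only [lt_iSup_iff] at h1
    obtain ⟨g, hg, h1⟩ := h1
    exact ⟨g, hg, tsub_le_iff_right.1 h1.le⟩

/-- The quadratic mean `m` of two near-maximizers stays in the hull, so `∫ |x| m` is at most the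
supremum and `∫ |x| (m - (g+h)/2) ≤ δ²`. The pointwise bound then yields `2Sδ + (3/(2δ)) δ²`. -/
theorem lintegral_abs_sub_le (hS : hullSup E x ≠ ∞) {g h : unitInterval → ℝ≥0}
    (hg : SqHull E g) (hh : SqHull E h) {δ : ℝ} (hδ : 0 < δ)
    (hgS : hullSup E x ≤ (∫⁻ t, ‖x t‖ₑ * g t) + ENNReal.ofReal (δ ^ 2))
    (hhS : hullSup E x ≤ (∫⁻ t, ‖x t‖ₑ * h t) + ENNReal.ofReal (δ ^ 2)) :
    ∫⁻ t, ‖x t‖ₑ * ENNReal.ofReal |(g t : ℝ) - h t| ≤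
      ENNReal.ofReal (δ * (2 * (hullSup E x).toReal + 3 / 2)) := by
  set S := (hullSup E x).toReal with hSdef
  have hint : ∀ w : unitInterval → ℝ≥0, SqHull E w → Integrable (fun t => |x t| * (w t : ℝ)) ∧
      ∫ t, |x t| * (w t : ℝ) = (∫⁻ t, ‖x t‖ₑ * w t).toReal := fun w hw => by
    have hm : Measurable fun t => ‖x t‖ₑ * w t :=
      x.measurable_enorm_mul hw.measurable.coe_nnreal_ennreal
    have hfin : ∫⁻ t, ‖x t‖ₑ * w t ≠ ∞ := ((le_hullSup hw).trans_lt hS.lt_top).ne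
    have heq : (fun t => |x t| * (w t : ℝ)) = fun t => (‖x t‖ₑ * w t).toReal := by
      funext t; simp
    rw [heq]
    exact ⟨integrable_toReal_of_lintegral_ne_top hm.aemeasurable hfin,
      integral_toReal hm.aemeasurable (.of_forall fun t => ENNReal.mul_lt_top (by simp) (by simp))⟩
  have hle : ∀ w : unitInterval → ℝ≥0, SqHull E w → ∫ t, |x t| * (w t : ℝ) ≤ S := fun w hw => by
    rw [(hint w hw).2]
    exact ENNReal.toReal_mono hS (le_hullSup hw)
  have hge : ∀ w : unitInterval → ℝ≥0, SqHull E w →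
      hullSup E x ≤ (∫⁻ t, ‖x t‖ₑ * w t) + ENNReal.ofReal (δ ^ 2) →
      S - δ ^ 2 ≤ ∫ t, |x t| * (w t : ℝ) := fun w hw hwS => by
    rw [(hint w hw).2]
    have hfin : ∫⁻ t, ‖x t‖ₑ * w t ≠ ∞ := ((le_hullSup hw).trans_lt hS.lt_top).ne
    have h1 := ENNReal.toReal_mono (by simp [hfin]) hwS
    rw [ENNReal.toReal_add hfin (by simp), ENNReal.toReal_ofReal (by positivity)] at h1
    linarith
  set a : ℝ≥0 := NNReal.sqrt 2⁻¹ with ha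
  have ha2 : a ^ 2 = 2⁻¹ := NNReal.sq_sqrt _
  have hmid := hg.combine hh (a := a) (b := a) (by rw [ha2]; norm_num)
  set m : unitInterval → ℝ≥0 := fun t => NNReal.sqrt ((a * g t) ^ 2 + (a * h t) ^ 2) with hm
  have hmsq : ∀ t, (m t : ℝ) ^ 2 = ((g t : ℝ) ^ 2 + (h t : ℝ) ^ 2) / 2 := fun t => by
    have : m t ^ 2 = (g t ^ 2 + h t ^ 2) / 2 := by
      simp only [hm]
      rw [NNReal.sq_sqrt, mul_pow, mul_pow, ha2]; ring
    exact_mod_cast congrArg NNReal.toReal this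
  obtain ⟨hg1, hg2⟩ := hint g hg
  obtain ⟨hh1, hh2⟩ := hint h hh
  obtain ⟨hm1, hm2⟩ := hint m hmid
  have hpt : ∀ t, |x t| * |(g t : ℝ) - h t| ≤
      δ * (|x t| * g t + |x t| * h t) +
        3 / (2 * δ) * (|x t| * m t - (|x t| * g t + |x t| * h t) / 2) := fun t => by
    have h1 := abs_sub_le_of_midpoint (g t).2 (h t).2 (m t).2 hδ (hmsq t)
    calc _ ≤ |x t| * (δ * ((g t : ℝ) + h t) + 3 / (2 * δ) * ((m t : ℝ) - ((g t : ℝ) + h t) / 2)) :=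
          mul_le_mul_of_nonneg_left h1 (abs_nonneg _)
      _ = _ := by ring
  have hdiff : Integrable fun t => |x t| * |(g t : ℝ) - h t| := by
    refine (hg1.sub hh1).abs.congr (.of_forall fun t => ?_)
    simp only [Pi.sub_apply]
    rw [← mul_sub, abs_mul, abs_abs]
  have hgh : Integrable fun t => |x t| * (g t : ℝ) + |x t| * (h t : ℝ) := hg1.add hh1
  have hmd : Integrable fun t =>
      |x t| * (m t : ℝ) - (|x t| * (g t : ℝ) + |x t| * (h t : ℝ)) / 2 :=
    hm1.sub (hgh.div_const 2)
  have hreal : ∫ t, |x t| * |(g t : ℝ) - h t| ≤ δ * (2 * S + 3 / 2) := by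
    calc _ ≤ ∫ t, (δ * (|x t| * g t + |x t| * h t) +
        3 / (2 * δ) * (|x t| * m t - (|x t| * g t + |x t| * h t) / 2)) := by
          exact integral_mono hdiff ((hgh.const_mul _).add (hmd.const_mul _)) hpt
      _ = δ * ((∫ t, |x t| * (g t : ℝ)) + ∫ t, |x t| * (h t : ℝ)) +
          3 / (2 * δ) * ((∫ t, |x t| * (m t : ℝ)) -
            ((∫ t, |x t| * (g t : ℝ)) + ∫ t, |x t| * (h t : ℝ)) / 2) := by
          rw [integral_add (hgh.const_mul _) (hmd.const_mul _), integral_const_mul,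
            integral_const_mul, integral_sub hm1 (hgh.div_const 2), integral_div,
            integral_add hg1 hh1]
      _ ≤ δ * (S + S) + 3 / (2 * δ) * (S - ((S - δ ^ 2) + (S - δ ^ 2)) / 2) := by
          have := hle g hg
          have := hle h hh
          have := hle m hmid
          have := hge g hg hgS
          have := hge h hh hhS
          gcongr
      _ = _ := by field_simp; ring
  calc _ = ∫⁻ t, ENNReal.ofReal (|x t| * |(g t : ℝ) - h t|) := by
        refine lintegral_congr fun t => ?_
        rw [ENNReal.ofReal_mul (abs_nonneg _), Real.enorm_eq_ofReal_abs]
    _ = ENNReal.ofReal (∫ t, |x t| * |(g t : ℝ) - h t|) :=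
        (ofReal_integral_eq_lintegral_ofReal hdiff (.of_forall fun t => by positivity)).symm
    _ ≤ _ := ENNReal.ofReal_le_ofReal hreal

/-- Existence of a maximizer, as a limit of a maximizing sequence. -/
theorem exists_maximizing_limit (hS : hullSup E x ≠ ∞) :
    ∃ (g : ℕ → unitInterval → ℝ≥0) (g₀ : unitInterval → ℝ≥0), (∀ n, SqHull E (g n)) ∧
      Measurable g₀ ∧
      (∀ᵐ t, (x t = 0 ∧ g₀ t = 0) ∨ (x t ≠ 0 ∧ Tendsto (fun n => g n t) atTop (𝓝 (g₀ t)))) ∧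
      hullSup E x ≤ ∫⁻ t, ‖x t‖ₑ * g₀ t := by
  set S := (hullSup E x).toReal with hSdef
  have hS0 : 0 ≤ S := ENNReal.toReal_nonneg
  have hδ : ∀ n : ℕ, (0 : ℝ) < (1 / 2) ^ n := fun n => by positivity
  -- A defect of `(2^{-n})²` makes the `L¹(|x| dm)` distances at most a constant times `2^{-n}`,
  -- which is summable.
  choose g hg hgS using fun n : ℕ => exists_hullSup_le_add hS
    (ε := ENNReal.ofReal (((1 / 2 : ℝ) ^ n) ^ 2)) (by simp)
  have hgS' : ∀ N n, N ≤ n →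
      hullSup E x ≤ (∫⁻ t, ‖x t‖ₑ * g n t) + ENNReal.ofReal (((1 / 2 : ℝ) ^ N) ^ 2) :=
    fun N n hn => (hgS n).trans (by
      gcongr ?_ + ENNReal.ofReal (?_ ^ 2)
      · exact le_rfl
      · exact pow_le_pow_of_le_one (by norm_num) (by norm_num) hn)
  have hcau : ∀ N n m, N ≤ n → N ≤ m →
      ∫⁻ t, ‖x t‖ₑ * ENNReal.ofReal |(g n t : ℝ) - g m t| ≤
        ENNReal.ofReal ((1 / 2) ^ N * (2 * S + 3 / 2)) := fun N n m hn hm =>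
    lintegral_abs_sub_le hS (hg n) (hg m) (hδ N) (hgS' N n hn) (hgS' N m hm)
  have hxm : Measurable fun t => x t := x.measurable
  have hgm : ∀ n, Measurable fun t => (g n t : ℝ) := fun n => (hg n).measurable.coe_nnreal_real
  have hlim : ∀ᵐ t, ∃ l, Tendsto (fun n => |x t| * (g n t : ℝ)) atTop (𝓝 l) := by
    refine Lp.ae_tendsto_of_cauchy_eLpNorm (p := 1) (μ := volume)
      (f := fun n t => |x t| * (g n t : ℝ))
      -- `2` in place of `3/2`, since a strict bound is required.
      (B := fun N => ENNReal.ofReal ((1 / 2) ^ N * (2 * S + 2))) (fun n => by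
        have := hgm n
        exact Measurable.aestronglyMeasurable (by fun_prop)) le_rfl ?_ ?_
    · exact (Summable.mul_right _ (summable_geometric_of_lt_one (by norm_num)
        (by norm_num))).tsum_ofReal_ne_top
    · intro N n m hn hm
      rw [eLpNorm_one_eq_lintegral_enorm]
      calc _ = ∫⁻ t, ‖x t‖ₑ * ENNReal.ofReal |(g n t : ℝ) - g m t| := by
            refine lintegral_congr fun t => ?_
            simp only [Pi.sub_apply]
            rw [← mul_sub, enorm_mul, Real.enorm_abs, Real.enorm_eq_ofReal_abs (_ - _)]
        _ ≤ _ := hcau N n m hn hm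
        _ < _ := by
            rw [ENNReal.ofReal_lt_ofReal_iff (by positivity)]
            have := hδ N
            gcongr
            norm_num
  -- Only `|x| g_n` is known to converge, so `g_n` is replaced by `0` on the zero set of `x`.
  have hwm : ∀ n, Measurable fun t => if x t = 0 then 0 else g n t := fun n =>
    Measurable.ite (hxm (measurableSet_singleton 0)) measurable_const (hg n).measurable
  obtain ⟨g₀, hg₀, hg₀lim⟩ := measurable_limit_of_tendsto_metrizable_ae (μ := volume)
    (f := fun n t => if x t = 0 then 0 else g n t) (L := atTop) (fun n => (hwm n).aemeasurable) (by
      filter_upwards [hlim] with t ⟨l, hl⟩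
      by_cases h0 : x t = 0
      · exact ⟨0, by simp [h0]⟩
      · simp only [h0, if_false]
        have h0' : |x t| ≠ 0 := by simpa using h0
        have h1 : Tendsto (fun n => (g n t : ℝ)) atTop (𝓝 (|x t|⁻¹ * l)) := by
          refine (hl.const_mul |x t|⁻¹).congr fun n => ?_
          rw [inv_mul_cancel_left₀ h0']
        exact ⟨_, (tendsto_real_toNNReal h1).congr fun n => Real.toNNReal_coe⟩)
  have hlim' : ∀ᵐ t, (x t = 0 ∧ g₀ t = 0) ∨
      (x t ≠ 0 ∧ Tendsto (fun n => g n t) atTop (𝓝 (g₀ t))) := by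
    filter_upwards [hg₀lim] with t ht
    by_cases h0 : x t = 0
    · left
      simp only [h0, if_true] at ht
      exact ⟨h0, tendsto_nhds_unique ht tendsto_const_nhds⟩
    · right
      simp only [h0, if_false] at ht
      exact ⟨h0, ht⟩
  refine ⟨g, g₀, hg, hg₀, hlim', ?_⟩
  have hg₀m := hg₀.coe_nnreal_real
  have hdist : ∀ N, ∫⁻ t, ‖x t‖ₑ * ENNReal.ofReal |(g N t : ℝ) - g₀ t| ≤
      ENNReal.ofReal ((1 / 2) ^ N * (2 * S + 3 / 2)) := fun N => by
    refine lintegral_le_of_ae_tendsto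
      (f := fun k t => ‖x t‖ₑ * ENNReal.ofReal |(g N t : ℝ) - g (N + k) t|) (fun k => ?_) ?_
      (fun k => hcau N N (N + k) le_rfl (Nat.le_add_right _ _))
    · have := hgm N
      have := hgm (N + k)
      fun_prop
    · filter_upwards [hlim'] with t ht
      rcases ht with ⟨h0, -⟩ | ⟨-, ht⟩
      · left; simp [h0]
      · right
        refine ENNReal.Tendsto.const_mul ?_ (.inr (by simp))
        refine ENNReal.tendsto_ofReal (Tendsto.abs (tendsto_const_nhds.sub ?_))
        refine (NNReal.continuous_coe.tendsto _).comp ?_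
        exact (ht.comp (tendsto_add_atTop_nat N)).congr fun k => by simp [add_comm]
  have hle : ∀ N, hullSup E x ≤ (∫⁻ t, ‖x t‖ₑ * g₀ t) +
      ENNReal.ofReal ((1 / 2) ^ N * (2 * S + 3 / 2)) + ENNReal.ofReal (((1 / 2 : ℝ) ^ N) ^ 2) :=
    fun N => by
      refine (hgS N).trans ?_
      gcongr
      calc ∫⁻ t, ‖x t‖ₑ * g N t
          ≤ ∫⁻ t, (‖x t‖ₑ * g₀ t + ‖x t‖ₑ * ENNReal.ofReal |(g N t : ℝ) - g₀ t|) := by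
            refine lintegral_mono fun t => ?_
            rw [← mul_add]
            gcongr
            rw [← ENNReal.ofReal_coe_nnreal, ← ENNReal.ofReal_coe_nnreal,
              ← ENNReal.ofReal_add (by positivity) (by positivity)]
            refine ENNReal.ofReal_le_ofReal ?_
            linarith [le_abs_self ((g N t : ℝ) - g₀ t)]
        _ = (∫⁻ t, ‖x t‖ₑ * g₀ t) + ∫⁻ t, ‖x t‖ₑ * ENNReal.ofReal |(g N t : ℝ) - g₀ t| :=
            lintegral_add_left (x.measurable_enorm_mul hg₀.coe_nnreal_ennreal) _
        _ ≤ _ := by gcongr; exact hdist N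
  have hpow : Tendsto (fun N : ℕ => (1 / 2 : ℝ) ^ N) atTop (𝓝 0) :=
    tendsto_pow_atTop_nhds_zero_of_lt_one (by norm_num) (by norm_num)
  have ht : Tendsto (fun N : ℕ => (∫⁻ t, ‖x t‖ₑ * g₀ t) +
      ENNReal.ofReal ((1 / 2) ^ N * (2 * S + 3 / 2)) + ENNReal.ofReal (((1 / 2 : ℝ) ^ N) ^ 2))
      atTop (𝓝 ((∫⁻ t, ‖x t‖ₑ * g₀ t) + ENNReal.ofReal (0 * (2 * S + 3 / 2)) +
        ENNReal.ofReal (0 ^ 2))) :=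
    (tendsto_const_nhds.add (ENNReal.tendsto_ofReal (hpow.mul_const _))).add
      (ENNReal.tendsto_ofReal (hpow.pow 2))
  simp only [zero_mul, ENNReal.ofReal_zero, add_zero, ne_eq, OfNat.ofNat_ne_zero,
    not_false_eq_true, zero_pow] at ht
  exact ge_of_tendsto' ht hle

/-- The first order condition at the maximizer. -/
theorem lintegral_div_le_hullSup (hS : hullSup E x ≠ ∞) {g : ℕ → unitInterval → ℝ≥0}
    {g₀ : unitInterval → ℝ≥0} (hg : ∀ n, SqHull E (g n)) (hg₀ : Measurable g₀)
    (hlim : ∀ᵐ t, (x t = 0 ∧ g₀ t = 0) ∨ (x t ≠ 0 ∧ Tendsto (fun n => g n t) atTop (𝓝 (g₀ t))))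
    (hmax : hullSup E x ≤ ∫⁻ t, ‖x t‖ₑ * g₀ t) {u : unitInterval → ℝ≥0} (hu : Measurable u)
    (hu1 : dualNorm E u ≤ 1) :
    ∫⁻ t, ‖x t‖ₑ * (u t : ℝ≥0∞) ^ 2 / (2 * g₀ t) ≤ hullSup E x := by
  have hsq : Continuous NNReal.sqrt := NNReal.continuous_sqrt
  have hsqm : Measurable NNReal.sqrt := hsq.measurable
  -- A difference-quotient form of the first order condition, exact for each fixed `b > 0`; letting
  -- `b → 0` turns the denominator into `2 g₀`.
  have key : ∀ a b : ℝ≥0, b ≠ 0 → a ^ 2 + b ^ 2 = 1 →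
      ∫⁻ t, ‖x t‖ₑ * (u t : ℝ≥0∞) ^ 2 /
        ((NNReal.sqrt ((a * g₀ t) ^ 2 + (b * u t) ^ 2) + a * g₀ t : ℝ≥0) : ℝ≥0∞) ≤
        hullSup E x := by
    intro a b hb hab
    set m : unitInterval → ℝ≥0 := fun t => NNReal.sqrt ((a * g₀ t) ^ 2 + (b * u t) ^ 2) with hm
    have hmm : Measurable m := hsqm.comp (by fun_prop)
    have h1 : ∫⁻ t, ‖x t‖ₑ * m t ≤ hullSup E x := by
      refine lintegral_le_of_ae_tendsto (f := fun n t => ‖x t‖ₑ *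
        (NNReal.sqrt ((a * g n t) ^ 2 + (b * u t) ^ 2) : ℝ≥0)) (fun n => ?_) ?_
        (fun n => le_hullSup ((hg n).combine (.of_dualNorm_le_one hu hu1) hab.le))
      · exact x.measurable_enorm_mul
          ((hg n).combine (.of_dualNorm_le_one hu hu1) hab.le).measurable.coe_nnreal_ennreal
      · filter_upwards [hlim] with t ht
        rcases ht with ⟨h0, -⟩ | ⟨-, ht⟩
        · left; simp [h0]
        · right
          refine ENNReal.Tendsto.const_mul (ENNReal.tendsto_coe.2 ?_) (.inr (by simp))
          exact (hsq.tendsto _).comp (((ht.const_mul a).pow 2).add_const _)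
    set Q := ∫⁻ t, ‖x t‖ₑ * (u t : ℝ≥0∞) ^ 2 / ((m t + a * g₀ t : ℝ≥0) : ℝ≥0∞) with hQ
    -- Rationalization: `m² - (a g₀)² = (b u)²`.
    have hpt : ∀ t, a * g₀ t + b ^ 2 * (u t ^ 2 / (m t + a * g₀ t)) = m t := fun t => by
      have hmsq : m t ^ 2 = (a * g₀ t) ^ 2 + (b * u t) ^ 2 := NNReal.sq_sqrt _
      rcases eq_or_ne (m t + a * g₀ t) 0 with h0 | h0
      · obtain ⟨h2, h3⟩ := add_eq_zero.1 h0
        rw [h0, h2, h3]; simp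
      · rw [← mul_left_inj' h0, add_mul, mul_assoc (b ^ 2), div_mul_cancel₀ _ h0]
        calc _ = a * g₀ t * m t + ((a * g₀ t) ^ 2 + (b * u t) ^ 2) := by ring
          _ = _ := by rw [← hmsq]; ring
    have h2 : (a : ℝ≥0∞) * (∫⁻ t, ‖x t‖ₑ * g₀ t) + (b : ℝ≥0∞) ^ 2 * Q ≤ hullSup E x := by
      have hQm : Measurable fun t =>
          ‖x t‖ₑ * (u t : ℝ≥0∞) ^ 2 / ((m t + a * g₀ t : ℝ≥0) : ℝ≥0∞) := by
        have := x.measurable_enorm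
        have : Measurable fun t => m t + a * g₀ t := hmm.add (hg₀.const_mul a)
        fun_prop
      rw [hQ, ← lintegral_const_mul _ (x.measurable_enorm_mul hg₀.coe_nnreal_ennreal),
        ← lintegral_const_mul _ hQm, ← lintegral_add_right _ (hQm.const_mul _)]
      refine le_trans (lintegral_mono fun t => le_of_eq ?_) h1
      rcases eq_or_ne (m t + a * g₀ t) 0 with h0 | h0
      · obtain ⟨h2, h3⟩ := add_eq_zero.1 h0
        have h4 : u t = 0 := by
          have hmsq : m t ^ 2 = (a * g₀ t) ^ 2 + (b * u t) ^ 2 := NNReal.sq_sqrt _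
          rw [h2, h3] at hmsq
          simpa [hb] using hmsq.symm
        rw [h2, h4, mul_left_comm, ← ENNReal.coe_mul, h3]; simp
      · conv_rhs => rw [← hpt t, ENNReal.coe_add, ENNReal.coe_mul (b ^ 2), ENNReal.coe_div h0, mul_add]
        push_cast
        rw [mul_left_comm ‖x t‖ₑ (a : ℝ≥0∞), mul_left_comm ‖x t‖ₑ ((b : ℝ≥0∞) ^ 2), mul_div_assoc]
    -- `1 = a² + b² ≤ a + b²` because `a ≤ 1`. Compared with `h2` and the maximality of `g₀`, this
    -- lets `a * hullSup E x` cancel and leaves `Q ≤ hullSup E x`.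
    have h3 : hullSup E x ≤ a * hullSup E x + (b : ℝ≥0∞) ^ 2 * hullSup E x := by
      rw [← add_mul]
      refine le_mul_of_one_le_left zero_le ?_
      have ha1 : a ≤ 1 := by
        rw [← pow_le_one_iff_of_nonneg zero_le two_ne_zero, ← hab]; exact le_self_add
      have : (1 : ℝ≥0) ≤ a + b ^ 2 := by
        rw [← hab]
        gcongr
        rw [sq]; exact mul_le_of_le_one_left zero_le ha1
      exact_mod_cast this
    have h4 : a * hullSup E x + (b : ℝ≥0∞) ^ 2 * Q ≤
        a * hullSup E x + (b : ℝ≥0∞) ^ 2 * hullSup E x := by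
      refine le_trans ?_ h3
      refine le_trans ?_ h2
      gcongr
    rw [ENNReal.add_le_add_iff_left (ENNReal.mul_ne_top (by simp) hS)] at h4
    rwa [ENNReal.mul_le_mul_iff_right (by simpa using hb) (by simp)] at h4
  have hb0 : Tendsto (fun k : ℕ => (1 / ((k : ℝ≥0) + 1))) atTop (𝓝 0) :=
    tendsto_one_div_add_atTop_nhds_zero_nat
  have ha0 : Tendsto (fun k : ℕ => NNReal.sqrt (1 - (1 / ((k : ℝ≥0) + 1)) ^ 2)) atTop (𝓝 1) := by
    have h1 : Tendsto (fun k : ℕ => NNReal.sqrt (1 - (1 / ((k : ℝ≥0) + 1)) ^ 2)) atTop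
        (𝓝 (NNReal.sqrt (1 - 0 ^ 2))) :=
      (hsq.tendsto _).comp (Tendsto.sub tendsto_const_nhds (hb0.pow 2))
    simpa using h1
  refine lintegral_le_of_ae_tendsto (f := fun (k : ℕ) t => ‖x t‖ₑ * (u t : ℝ≥0∞) ^ 2 /
        ((NNReal.sqrt ((NNReal.sqrt (1 - (1 / ((k : ℝ≥0) + 1)) ^ 2) * g₀ t) ^ 2 +
          (1 / ((k : ℝ≥0) + 1) * u t) ^ 2) +
          NNReal.sqrt (1 - (1 / ((k : ℝ≥0) + 1)) ^ 2) * g₀ t : ℝ≥0) : ℝ≥0∞))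
    (fun k => ?_) (.of_forall fun t => ?_) (fun k => key _ _ (by positivity) ?_)
  · have := x.measurable_enorm
    have : Measurable fun t => NNReal.sqrt ((NNReal.sqrt (1 - (1 / ((k : ℝ≥0) + 1)) ^ 2) * g₀ t) ^ 2 +
          (1 / ((k : ℝ≥0) + 1) * u t) ^ 2) +
          NNReal.sqrt (1 - (1 / ((k : ℝ≥0) + 1)) ^ 2) * g₀ t :=
      (hsqm.comp (by fun_prop)).add (hg₀.const_mul _)
    fun_prop
  · rcases eq_or_ne (‖x t‖ₑ * (u t : ℝ≥0∞) ^ 2) 0 with h0 | h0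
    · left; simp [h0]
    · right
      have h1 := ((hsq.tendsto _).comp (((ha0.mul_const (g₀ t)).pow 2).add
        ((hb0.mul_const (u t)).pow 2))).add (ha0.mul_const (g₀ t))
      have h2 : NNReal.sqrt ((1 * g₀ t) ^ 2 + (0 * u t) ^ 2) + 1 * g₀ t = 2 * g₀ t := by
        simp; ring
      rw [h2] at h1
      have h3 := ENNReal.tendsto_coe.2 h1
      rw [ENNReal.coe_mul] at h3
      exact ENNReal.Tendsto.div tendsto_const_nhds (.inl h0) h3
        (.inr (ENNReal.mul_ne_top (by simp) (by simp)))
  · rw [NNReal.sq_sqrt, tsub_add_cancel_of_le]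
    refine pow_le_one₀ zero_le ?_
    rw [div_le_one (by positivity)]
    exact le_add_self

end Maximizer

/-! ### The factorization. -/

/-- The inclusion `E ⊆ F ⊙ E^×`. -/
theorem IsSymmetricBanachSpace.pointwiseProduct_le {E : LZero → ℝ≥0∞}
    (hE : IsSymmetricBanachSpace E) {C : ℝ≥0} (hC : LowerEstimate 2 C E)
    (h1 : dualNorm E 1 < ∞) {x : LZero} (hx : E x < ∞) :
    pointwiseProduct (kotheDual (powerSpace (1 / 2) (kotheDual E))) (kotheDual E) x ≤
      (2 * C ^ 2 : ℝ≥0) * E x := by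
  have hSle := hullSup_le hE hC hx
  have hS : hullSup E x ≠ ∞ := (hSle.trans_lt (ENNReal.mul_lt_top hx (by simp))).ne
  obtain ⟨g, g₀, hg, hg₀, hlim, hmax⟩ := exists_maximizing_limit hS
  have hfoc := fun {u : unitInterval → ℝ≥0} (hu : Measurable u) (hu1 : dualNorm E u ≤ 1) =>
    lintegral_div_le_hullSup hS hg hg₀ hlim hmax hu hu1
  have hdual : dualNorm E g₀ ≤ C := by
    refine dualNorm_le_of_ae_tendsto (fun n => (hg n).measurable) ?_ fun n => (hg n).dualNorm_le hE hC
    filter_upwards [hlim] with t ht using ht.imp (·.2) (·.2)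
  have hxm : Measurable fun t => x t := x.measurable
  -- Apply the first order condition to a positive constant `u`, available since `1 ∈ E^×`: where
  -- `g₀ = 0` and `x ≠ 0` the integrand would be `∞`, against the finiteness of the integral.
  have hzero : ∀ᵐ t, g₀ t = 0 → x t = 0 := by
    obtain ⟨c, hc0, hc⟩ : ∃ c : ℝ≥0, c ≠ 0 ∧ dualNorm E (fun _ => c) ≤ 1 := by
      obtain ⟨d, hd⟩ : ∃ d : ℝ≥0, dualNorm E 1 = d := ⟨_, (ENNReal.coe_toNNReal h1.ne).symm⟩
      refine ⟨(d + 1)⁻¹, by positivity, ?_⟩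
      have h2 := dualNorm_const_mul (E := E) (u := 1) (d + 1)⁻¹ measurable_one
      simp only [Pi.one_apply, mul_one] at h2
      rw [h2, hd, ← ENNReal.coe_mul, ENNReal.coe_le_one_iff, inv_mul_le_one₀ (by positivity)]
      exact le_self_add
    have hfin := ((hfoc measurable_const hc).trans_lt hS.lt_top).ne
    have hm : Measurable fun t => ‖x t‖ₑ * (c : ℝ≥0∞) ^ 2 / (2 * g₀ t) := by fun_prop
    filter_upwards [ae_lt_top hm hfin] with t ht h0
    by_contra hx0
    rw [h0, ENNReal.coe_zero, mul_zero, ENNReal.div_zero] at ht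
    · exact lt_irrefl _ ht
    · simp [hx0, hc0]
  have hfm : Measurable fun t => x t / (g₀ t : ℝ) := hxm.div hg₀.coe_nnreal_real
  set f : LZero := AEEqFun.mk (fun t => x t / (g₀ t : ℝ)) hfm.aestronglyMeasurable with hf
  have hfc : f =ᵐ[volume] fun t => x t / (g₀ t : ℝ) := AEEqFun.coeFn_mk _ _
  have hgc := coeFn_nnClass g₀ hg₀
  have hFf : kotheDual (powerSpace (1 / 2) (kotheDual E)) f ≤ 2 * (E x * C) := by
    rw [kotheDual_powerSpace_eq]
    refine sqDualNorm_le_iff.2 fun u hu hu1 => ?_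
    have hm : Measurable fun t => ‖x t‖ₑ * (u t : ℝ≥0∞) ^ 2 / (2 * g₀ t) := by fun_prop
    calc ∫⁻ t, (‖f t‖₊ : ℝ≥0∞) * (u t : ℝ≥0∞) ^ 2
        ≤ ∫⁻ t, 2 * (‖x t‖ₑ * (u t : ℝ≥0∞) ^ 2 / (2 * g₀ t)) := by
          refine lintegral_mono_ae ?_
          filter_upwards [hfc] with t ht
          rw [ht]
          rcases eq_or_ne (g₀ t) 0 with h0 | h0
          · simp [h0]
          · have : ‖x t‖ₑ * (u t : ℝ≥0∞) ^ 2 / (2 * g₀ t) =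
                ((‖x t‖₊ * u t ^ 2 / (2 * g₀ t) : ℝ≥0) : ℝ≥0∞) := by
              rw [ENNReal.coe_div (by positivity)]; push_cast; rfl
            rw [this]
            norm_cast
            rw [nnnorm_div, NNReal.nnnorm_eq]
            refine le_of_eq ?_
            field_simp
      _ = 2 * ∫⁻ t, ‖x t‖ₑ * (u t : ℝ≥0∞) ^ 2 / (2 * g₀ t) := lintegral_const_mul _ hm
      _ ≤ _ := by gcongr; exact (hfoc hu hu1).trans hSle
  have hGg : kotheDual E (nnClass g₀ hg₀) ≤ C := by
    rw [kotheDual_eq_dualNorm]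
    refine (dualNorm_mono ?_).trans hdual
    filter_upwards [hgc] with t ht
    rw [ht, NNReal.nnnorm_eq]
  have hprod : x = f * nnClass g₀ hg₀ := by
    apply AEEqFun.ext
    filter_upwards [AEEqFun.coeFn_mul f (nnClass g₀ hg₀), hfc, hgc, hzero] with t h1 h2 h3 h4
    rw [h1, Pi.mul_apply, h2, h3]
    rcases eq_or_ne (g₀ t) 0 with h0 | h0
    · simp [h0, h4 h0]
    · rw [div_mul_cancel₀ _ (by simpa using h0)]
  calc _ ≤ kotheDual (powerSpace (1 / 2) (kotheDual E)) f * kotheDual E (nnClass g₀ hg₀) := by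
        refine iInf_le_of_le f (iInf_le_of_le (nnClass g₀ hg₀) ?_)
        refine iInf_le_of_le (hFf.trans_lt ?_) (iInf_le_of_le (hGg.trans_lt (by simp))
          (iInf_le_of_le hprod le_rfl))
        exact ENNReal.mul_lt_top (by simp) (ENNReal.mul_lt_top hx (by simp))
    _ ≤ 2 * (E x * C) * C := by gcongr
    _ = _ := by push_cast; ring

/-! ### Order continuity of the norm of `F`. -/

theorem sum_range_sub_le_of_antitone {a : ℕ → ℝ≥0} (ha : Antitone a) (N : ℕ) :
    ∑ j ∈ Finset.range N, (a j - a (j + 1)) ≤ a 0 := by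
  have : ∑ j ∈ Finset.range N, (a j - a (j + 1)) + a N = a 0 := by
    induction N with
    | zero => simp
    | succ N ih => rw [Finset.sum_range_succ, add_assoc, tsub_add_cancel_of_le (ha N.le_succ), ih]
  exact this ▸ le_self_add

theorem exists_nat_mul_rpow_lt {p K d : ℝ} (hp : p < 1) (hd : 0 < d) :
    ∃ N : ℕ, K * (N : ℝ) ^ p < N * d := by
  have h1 := (tendsto_rpow_atTop (sub_pos.2 hp)).comp tendsto_natCast_atTop_atTop
  obtain ⟨N, hN, hN0⟩ := ((h1.eventually_gt_atTop (K / d)).and (eventually_gt_atTop 0)).exists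
  have hN0' : (0 : ℝ) < N := by exact_mod_cast hN0
  refine ⟨N, ?_⟩
  have h2 : K / d < (N : ℝ) ^ (1 - p) := hN
  rw [div_lt_iff₀ hd] at h2
  calc K * (N : ℝ) ^ p < (N : ℝ) ^ (1 - p) * d * (N : ℝ) ^ p := by gcongr
    _ = (N : ℝ) ^ (1 - p) * (N : ℝ) ^ p * d := by ring
    _ = _ := by rw [← Real.rpow_add hN0']; simp

namespace IsSymmetricBanachSpace

variable {E : LZero → ℝ≥0∞} (hE : IsSymmetricBanachSpace E)
include hE

/-- Order continuity of the norm of `F`. -/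
theorem exists_sqDualNorm_le_of_antitone {β : ℝ} (hβ₁ : 1 < β) (hβ₂ : β < 2) {C : ℝ≥0}
    (h : LowerEstimate β C E) {v : ℕ → unitInterval → ℝ≥0} (hv : ∀ n, Measurable (v n))
    (hanti : ∀ t, Antitone fun n => v n t) (hlim : ∀ᵐ t, Tendsto (fun n => v n t) atTop (𝓝 0))
    (hfin : sqDualNorm E (v 0) ≠ ∞) {ε : ℝ≥0∞} (hε : 0 < ε) : ∃ n, sqDualNorm E (v n) ≤ ε := by
  by_contra! hcon
  obtain ⟨δ, hδ0, hδε⟩ : ∃ δ : ℝ≥0, 0 < δ ∧ (δ : ℝ≥0∞) ≤ ε := by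
    rcases eq_or_ne ε ∞ with rfl | hε'
    · exact ⟨1, one_pos, le_top⟩
    · exact ⟨ε.toNNReal, ENNReal.toNNReal_pos hε.ne' hε', ENNReal.coe_toNNReal_le_self⟩
  have hex : ∀ n, ∃ g : unitInterval → ℝ≥0, Measurable g ∧ dualNorm E g ≤ 1 ∧
      (δ : ℝ≥0∞) < ∫⁻ t, (v n t : ℝ≥0∞) * (g t : ℝ≥0∞) ^ 2 := fun n => by
    have h1 := hδε.trans_lt (hcon n)
    simp only [sqDualNorm, lt_iSup_iff] at h1
    obtain ⟨g, hg, hg1, h2⟩ := h1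
    exact ⟨g, hg, hg1, h2⟩
  choose g hg hg1 hgδ using hex
  -- Dominated convergence for the fixed weight `g_n²`: far enough along, `v_m` loses at least half
  -- of the mass `δ` that `g_n` detects. So each increment `v_{φ j} - v_{φ (j+1)}` keeps at least
  -- `δ/2` against its own `g_{φ j}²`.
  have hnext : ∀ n, ∃ m, n ≤ m ∧
      ∫⁻ t, (v m t : ℝ≥0∞) * (g n t : ℝ≥0∞) ^ 2 ≤ (δ / 2 : ℝ≥0) := fun n => by
    have h1 : Tendsto (fun m => ∫⁻ t, (v m t : ℝ≥0∞) * (g n t : ℝ≥0∞) ^ 2) atTop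
        (𝓝 (∫⁻ t : unitInterval, 0)) := by
      refine tendsto_lintegral_of_dominated_convergence
        (fun t => (v 0 t : ℝ≥0∞) * (g n t : ℝ≥0∞) ^ 2) (fun m => ?_) (fun m => ?_) ?_ ?_
      · have := hv m
        have := hg n
        fun_prop
      · refine .of_forall fun t => ?_
        have := hanti t (Nat.zero_le m)
        simp only at this ⊢
        gcongr
      · exact ((sqDualNorm_le_iff.1 le_rfl _ (hg n) (hg1 n)).trans_lt hfin.lt_top).ne
      · filter_upwards [hlim] with t ht
        have h2 := ENNReal.Tendsto.mul_const (b := (g n t : ℝ≥0∞) ^ 2) (ENNReal.tendsto_coe.2 ht)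
          (.inr (by simp))
        simpa using h2
    rw [lintegral_zero] at h1
    have h2 : (0 : ℝ≥0∞) < (δ / 2 : ℝ≥0) := by simpa using hδ0.ne'
    obtain ⟨m, hm, hnm⟩ := ((h1.eventually (gt_mem_nhds h2)).and (eventually_ge_atTop n)).exists
    exact ⟨m, hnm, hm.le⟩
  choose f hf hfδ using hnext
  set φ : ℕ → ℕ := fun j => f^[j] 0 with hφ
  have hφs : ∀ j, φ (j + 1) = f (φ j) := fun j => Function.iterate_succ_apply' f j 0
  have hφm : Monotone φ := monotone_nat_of_le_succ fun j => by rw [hφs]; exact hf _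
  have hstep : ∀ j, ((δ / 2 : ℝ≥0) : ℝ≥0∞) ≤
      ∫⁻ t, ((v (φ j) t - v (φ (j + 1)) t : ℝ≥0) : ℝ≥0∞) * (g (φ j) t : ℝ≥0∞) ^ 2 := fun j => by
    have h1 : ∫⁻ t, (v (φ j) t : ℝ≥0∞) * (g (φ j) t : ℝ≥0∞) ^ 2 =
        (∫⁻ t, ((v (φ j) t - v (φ (j + 1)) t : ℝ≥0) : ℝ≥0∞) * (g (φ j) t : ℝ≥0∞) ^ 2) +
          ∫⁻ t, (v (φ (j + 1)) t : ℝ≥0∞) * (g (φ j) t : ℝ≥0∞) ^ 2 := by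
      have := hv (φ (j + 1))
      have := hg (φ j)
      rw [← lintegral_add_right _ (by fun_prop)]
      refine lintegral_congr fun t => ?_
      rw [← add_mul, ← ENNReal.coe_add, tsub_add_cancel_of_le (hanti t (hφm j.le_succ))]
    have h2 := (hgδ (φ j)).le
    have h3 : ∫⁻ t, (v (φ (j + 1)) t : ℝ≥0∞) * (g (φ j) t : ℝ≥0∞) ^ 2 ≤ (δ / 2 : ℝ≥0) := by
      rw [hφs]; exact hfδ _
    rw [h1] at h2
    refine (ENNReal.add_le_add_iff_right (a := ((δ / 2 : ℝ≥0) : ℝ≥0∞))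
      ENNReal.coe_ne_top).1 ?_
    rw [← ENNReal.coe_add, add_halves]
    exact h2.trans (by gcongr)
  have hq := Real.HolderConjugate.conjExponent hβ₁
  set q := Real.conjExponent β with hqdef
  have hq0 : 0 < q := hq.symm.pos
  have hq2 : 2 / q < 1 := by
    rw [div_lt_one hq0, hqdef, Real.conjExponent, lt_div_iff₀ (by linarith)]
    linarith
  obtain ⟨Φ, hΦ⟩ : ∃ Φ : ℝ≥0, sqDualNorm E (v 0) = Φ := ⟨_, (ENNReal.coe_toNNReal hfin).symm⟩
  -- The `ℓ^q`-combination `G` dominates all `N` test functions, yet `q`-convexity bounds its norm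
  -- by `C N^{1/q}`. Tested against `G²`, the increments telescope to at most `v_0`.
  have key : ∀ N : ℕ, (N : ℝ≥0) * (δ / 2) ≤ Φ * C ^ 2 * (N : ℝ≥0) ^ (2 / q) := fun N => by
    set G : unitInterval → ℝ≥0 := fun t => (∑ j : Fin N, g (φ j) t ^ q) ^ (1 / q) with hG
    have hGm : Measurable G := by
      have := fun j : Fin N => hg (φ j)
      fun_prop
    have hGd : dualNorm E G ≤ (C * (N : ℝ≥0) ^ (1 / q) : ℝ≥0) := by
      refine (hE.dualNorm_rpow_sum_le hq h fun j : Fin N => hg (φ j)).trans ?_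
      rw [ENNReal.coe_mul, ENNReal.coe_rpow_of_nonneg _ (by positivity)]
      gcongr
      calc ∑ j : Fin N, dualNorm E (g (φ j)) ^ q ≤ ∑ j : Fin N, 1 :=
            Finset.sum_le_sum fun j _ => ENNReal.rpow_le_one (hg1 _) hq0.le
        _ = _ := by simp
    have hgG : ∀ j < N, ∀ t, g (φ j) t ≤ G t := fun j hj t => by
      calc g (φ j) t = (g (φ j) t ^ q) ^ (1 / q) := by
            rw [← NNReal.rpow_mul, mul_one_div_cancel hq0.ne', NNReal.rpow_one]
        _ ≤ _ := by
            refine NNReal.rpow_le_rpow ?_ (by positivity)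
            exact Finset.single_le_sum (f := fun j : Fin N => g (φ j) t ^ q)
              (fun _ _ => zero_le) (Finset.mem_univ (⟨j, hj⟩ : Fin N))
    have h1 : (N : ℝ≥0∞) * ((δ / 2 : ℝ≥0) : ℝ≥0∞) ≤ Φ * (C * (N : ℝ≥0) ^ (1 / q) : ℝ≥0) ^ 2 := by
      calc (N : ℝ≥0∞) * ((δ / 2 : ℝ≥0) : ℝ≥0∞)
          = ∑ j ∈ Finset.range N, ((δ / 2 : ℝ≥0) : ℝ≥0∞) := by simp
        _ ≤ ∑ j ∈ Finset.range N, ∫⁻ t, ((v (φ j) t - v (φ (j + 1)) t : ℝ≥0) : ℝ≥0∞) *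
              (G t : ℝ≥0∞) ^ 2 := by
            refine Finset.sum_le_sum fun j hj => (hstep j).trans (lintegral_mono fun t => ?_)
            have := hgG j (Finset.mem_range.1 hj) t
            gcongr
        _ = ∫⁻ t, ∑ j ∈ Finset.range N, ((v (φ j) t - v (φ (j + 1)) t : ℝ≥0) : ℝ≥0∞) *
              (G t : ℝ≥0∞) ^ 2 := by
            refine (lintegral_finsetSum _ fun j _ => ?_).symm
            have := hv (φ j)
            have := hv (φ (j + 1))
            fun_prop
        _ ≤ ∫⁻ t, (v 0 t : ℝ≥0∞) * (G t : ℝ≥0∞) ^ 2 := by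
            refine lintegral_mono fun t => ?_
            rw [← Finset.sum_mul]
            gcongr
            have h3 : ∑ j ∈ Finset.range N, (v (φ j) t - v (φ (j + 1)) t) ≤ v 0 t :=
              sum_range_sub_le_of_antitone
                (a := fun j => v (φ j) t) (fun i j hij => hanti t (hφm hij)) N
            rw [← ENNReal.ofNNReal_finsetSum]
            exact ENNReal.coe_le_coe.2 h3
        _ ≤ sqDualNorm E (v 0) * dualNorm E G ^ 2 :=
            hE.lintegral_mul_sq_le hGm (hGd.trans_lt ENNReal.coe_lt_top).ne
        _ ≤ _ := by rw [hΦ]; gcongr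
    have h2 : (N : ℝ≥0) * (δ / 2) ≤ Φ * (C * (N : ℝ≥0) ^ (1 / q)) ^ 2 := by exact_mod_cast h1
    refine h2.trans (le_of_eq ?_)
    rw [mul_pow, ← NNReal.rpow_natCast ((N : ℝ≥0) ^ (1 / q)), ← NNReal.rpow_mul, mul_assoc]
    congr 3
    push_cast; ring
  obtain ⟨N, hN⟩ := exists_nat_mul_rpow_lt (p := 2 / q) (K := Φ * C ^ 2) (d := δ / 2) hq2
    (by positivity)
  exact hN.not_ge (by exact_mod_cast key N)

omit hE in
theorem sqDualNorm_const_lt_top (h1 : sqDualNorm E 1 < ∞) (c : ℝ≥0) :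
    sqDualNorm E (fun _ => c) < ∞ := by
  refine lt_of_le_of_lt (b := c * sqDualNorm E 1) (sqDualNorm_le_iff.2 fun u hu hu1 => ?_)
    (ENNReal.mul_lt_top (by simp) h1)
  rw [lintegral_const_mul _ (by fun_prop)]
  gcongr
  simpa using sqDualNorm_le_iff.1 (le_refl (sqDualNorm E 1)) u hu hu1

/-- Tail suprema replace the sequence by a decreasing one that still tends to `0`; its first term is
bounded, hence has finite norm because `1 ∈ F`. -/
theorem exists_sqDualNorm_le_of_bounded {β : ℝ} (hβ₁ : 1 < β) (hβ₂ : β < 2) {C : ℝ≥0}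
    (h : LowerEstimate β C E) {w : ℕ → unitInterval → ℝ≥0} (hw : ∀ n, Measurable (w n))
    {c : ℝ≥0} (hc : ∀ n t, w n t ≤ c) (hlim : ∀ᵐ t, Tendsto (fun n => w n t) atTop (𝓝 0))
    {ε : ℝ≥0∞} (hε : 0 < ε) : ∃ n, sqDualNorm E (w n) ≤ ε := by
  have hbdd : ∀ n t, BddAbove (Set.range fun k => w (n + k) t) := fun n t =>
    ⟨c, by rintro _ ⟨k, rfl⟩; exact hc _ _⟩
  have hanti : ∀ t, Antitone fun n => ⨆ k, w (n + k) t := fun t =>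
    antitone_nat_of_succ_le fun n => ciSup_le fun k => by
      have := le_ciSup (hbdd n t) (k + 1)
      simp only [show n + (k + 1) = n + 1 + k by ring] at this
      exact this
  have hsup : ∀ᵐ t, Tendsto (fun n => ⨆ k, w (n + k) t) atTop (𝓝 0) := by
    filter_upwards [hlim] with t ht
    refine tendsto_order.2 ⟨fun a ha => absurd ha not_lt_zero, fun a ha => ?_⟩
    obtain ⟨b, hb0, hba⟩ := exists_between ha
    obtain ⟨N, hN⟩ := eventually_atTop.1 ((tendsto_order.1 ht).2 b hb0)
    filter_upwards [eventually_ge_atTop N] with n hn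
    exact (ciSup_le fun k => (hN _ (by omega)).le).trans_lt hba
  have hfin : sqDualNorm E (fun t => ⨆ k, w (0 + k) t) ≠ ∞ :=
    ((sqDualNorm_mono (.of_forall fun t => ciSup_le fun k => hc _ _)).trans_lt
      (sqDualNorm_const_lt_top (hE.sqDualNorm_one_lt_top hβ₁ hβ₂ h) c)).ne
  obtain ⟨n, hn⟩ := hE.exists_sqDualNorm_le_of_antitone hβ₁ hβ₂ h
    (v := fun n t => ⨆ k, w (n + k) t) (fun n => Measurable.iSup fun k => hw _) hanti hsup hfin hε
  exact ⟨n, (sqDualNorm_mono (.of_forall fun t =>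
    le_ciSup (f := fun k => w (n + k) t) (hbdd n t) 0)).trans hn⟩

end IsSymmetricBanachSpace

/-! ### Separability of `F`. -/

/-- The truncation of a class at height `n`. -/
noncomputable def truncClass (n : ℕ) (x : LZero) : LZero :=
  x.compMeasurable (fun r : ℝ => max (-n) (min r n)) (by fun_prop)

theorem coeFn_truncClass (n : ℕ) (x : LZero) :
    truncClass n x =ᵐ[volume] fun t => max (-n : ℝ) (min (x t) n) :=
  AEEqFun.coeFn_compMeasurable _ _ _

theorem abs_max_neg_min_le (n : ℕ) (r : ℝ) : |max (-n : ℝ) (min r n)| ≤ n := by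
  have hn : (0 : ℝ) ≤ n := n.cast_nonneg
  exact abs_le.2 ⟨le_max_left _ _, max_le (by linarith) (min_le_right _ _)⟩

theorem nnnorm_sub_max_neg_min_le (n : ℕ) (r : ℝ) :
    ‖r - max (-n : ℝ) (min r n)‖₊ ≤ ‖r‖₊ - n := by
  have hn : (0 : ℝ) ≤ n := n.cast_nonneg
  rw [← NNReal.coe_le_coe, coe_nnnorm, NNReal.coe_sub_def, coe_nnnorm, NNReal.coe_natCast,
    Real.norm_eq_abs, Real.norm_eq_abs]
  rcases le_total r n with h1 | h1
  · rw [min_eq_left h1]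
    rcases le_total (-n : ℝ) r with h2 | h2
    · rw [max_eq_right h2]; simp
    · rw [max_eq_left h2, abs_of_nonpos (by linarith), abs_of_nonpos (by linarith)]
      exact le_max_of_le_left (by linarith)
  · rw [min_eq_right h1, max_eq_right (by linarith), abs_of_nonneg (by linarith),
      abs_of_nonneg (by linarith)]
    exact le_max_left _ _

/-- `L¹` is separable and `L¹`-convergence gives a.e. convergence of a subsequence. The a.e. form is
the one that dominated convergence in `F` can use. -/
theorem exists_countable_ae_dense : ∃ d : ℕ → LZero, ∀ y : LZero,
    Integrable y (volume : Measure unitInterval) →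
    ∃ k : ℕ → ℕ, ∀ᵐ t, Tendsto (fun i => d (k i) t) atTop (𝓝 (y t)) := by
  have : Fact ((1 : ℝ≥0∞) ≠ ∞) := ⟨by simp⟩
  refine ⟨fun k => (TopologicalSpace.denseSeq (Lp ℝ 1 (volume : Measure unitInterval)) k : LZero),
    fun y hy => ?_⟩
  have hyL : y ∈ Lp ℝ 1 (volume : Measure unitInterval) :=
    Lp.mem_Lp_iff_memLp.2 (memLp_one_iff_integrable.2 hy)
  have h1 := TopologicalSpace.denseRange_denseSeq (Lp ℝ 1 (volume : Measure unitInterval))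
    ⟨y, hyL⟩
  obtain ⟨a, ha, hlim⟩ := mem_closure_iff_seq_limit.1 h1
  choose k hk using ha
  obtain ⟨ns, -, hns⟩ := (tendstoInMeasure_of_tendsto_Lp hlim).exists_seq_tendsto_ae
  refine ⟨k ∘ ns, ?_⟩
  filter_upwards [hns] with t ht
  simpa [Function.comp, hk] using ht

/-- Split `x - T_n d = (x - T_n x) + (T_n x - T_n d)`, with `T_n` the truncation. The first part is
at most `(|x| - n)⁺`, which decreases to `0`; the second is bounded by `2n` and tends to `0` a.e.
along a suitable choice of `d`. -/
theorem IsSymmetricBanachSpace.isSeparableSpace {E : LZero → ℝ≥0∞}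
    (hE : IsSymmetricBanachSpace E) {β : ℝ} (hβ₁ : 1 < β) (hβ₂ : β < 2) {C : ℝ≥0}
    (h : LowerEstimate β C E) :
    IsSeparableSpace (kotheDual (powerSpace (1 / 2) (kotheDual E))) := by
  obtain ⟨d, hd⟩ := exists_countable_ae_dense
  have h1 := hE.sqDualNorm_one_lt_top hβ₁ hβ₂ h
  refine ⟨Set.range fun p : ℕ × ℕ => truncClass p.1 (d p.2), Set.countable_range _, ?_, ?_⟩
  · rintro _ ⟨⟨n, k⟩, rfl⟩
    change kotheDual _ _ < ∞
    rw [kotheDual_powerSpace_eq]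
    refine (sqDualNorm_mono ?_).trans_lt (sqDualNorm_const_lt_top h1 n)
    filter_upwards [coeFn_truncClass n (d k)] with t ht
    rw [ht, ← NNReal.coe_le_coe]
    exact abs_max_neg_min_le n _
  · intro x hx ε hε
    change kotheDual _ _ < ∞ at hx
    rw [kotheDual_powerSpace_eq] at hx
    have hxm := x.measurable_nnnorm
    obtain ⟨η, hη0, hηε⟩ : ∃ η : ℝ≥0∞, 0 < η ∧ η + η < ε := by
      obtain ⟨ε', h0, h'⟩ := exists_between hε
      exact ⟨ε' / 2, ENNReal.half_pos h0.ne', by rwa [ENNReal.add_halves]⟩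
    obtain ⟨n, hn⟩ := hE.exists_sqDualNorm_le_of_antitone hβ₁ hβ₂ h
      (v := fun n t => ‖x t‖₊ - n) (fun n => hxm.sub_const _)
      (fun t i j hij => tsub_le_tsub_left (by exact_mod_cast hij) _)
      (.of_forall fun t => by
        refine tendsto_const_nhds.congr' ?_
        obtain ⟨N, hN⟩ := exists_nat_ge ‖x t‖₊
        filter_upwards [eventually_ge_atTop N] with n hn
        exact (tsub_eq_zero_of_le (hN.trans (by exact_mod_cast hn))).symm)
      (by simpa using hx.ne) hη0
    set y := truncClass n x with hy
    have hyc := coeFn_truncClass n x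
    obtain ⟨k, hk⟩ := hd y (Integrable.of_bound y.aestronglyMeasurable n (by
      filter_upwards [hyc] with t ht
      rw [ht]; exact abs_max_neg_min_le n _))
    have hcont : Continuous fun r : ℝ => max (-n : ℝ) (min r n) := by fun_prop
    have hwm : ∀ i, Measurable fun t => ‖max (-n : ℝ) (min (x t) n) -
        max (-n : ℝ) (min (d (k i) t) n)‖₊ := fun i => by
      have := x.measurable
      have := (d (k i)).measurable
      fun_prop
    obtain ⟨i, hi⟩ := hE.exists_sqDualNorm_le_of_bounded hβ₁ hβ₂ h hwm (c := n + n)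
      (fun i t => (nnnorm_sub_le _ _).trans (add_le_add
        (NNReal.coe_le_coe.1 (abs_max_neg_min_le n _))
        (NNReal.coe_le_coe.1 (abs_max_neg_min_le n _)))) (by
      filter_upwards [hk, hyc] with t ht h2
      have h3 : Tendsto (fun i => max (-n : ℝ) (min (d (k i) t) n)) atTop
          (𝓝 (max (-n : ℝ) (min (y t) n))) := (hcont.tendsto _).comp ht
      have h4 : max (-n : ℝ) (min (y t) n) = max (-n : ℝ) (min (x t) n) := by
        have h5 := abs_le.1 (abs_max_neg_min_le n (x t))
        rw [h2, min_eq_left h5.2, max_eq_right h5.1]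
      rw [h4] at h3
      have h6 := (continuous_nnnorm.tendsto _).comp (tendsto_const_nhds (x := max (-n : ℝ) (min (x t) n)) |>.sub h3)
      rw [sub_self, nnnorm_zero] at h6
      exact h6) hη0
    refine ⟨_, ⟨(n, k i), rfl⟩, ?_⟩
    rw [kotheDual_powerSpace_eq]
    refine lt_of_le_of_lt ?_ hηε
    refine le_trans (sqDualNorm_mono ?_) ((sqDualNorm_add_le (hxm.sub_const (n : ℝ≥0))).trans (add_le_add hn hi))
    filter_upwards [AEEqFun.coeFn_sub x (truncClass n (d (k i))), coeFn_truncClass n (d (k i))]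
      with t h2 h3
    rw [h2, Pi.sub_apply, h3]
    calc _ = ‖(x t - max (-n : ℝ) (min (x t) n)) +
          (max (-n : ℝ) (min (x t) n) - max (-n : ℝ) (min (d (k i) t) n))‖₊ := by
          congr 1; ring
      _ ≤ _ := (nnnorm_add_le _ _).trans (add_le_add (nnnorm_sub_max_neg_min_le n _) le_rfl)

theorem proposition1p3 (E : LZero → ℝ≥0∞) (hE : IsSymmetricBanachSpace E)
    (α β : ℝ) (hα : 1 < α) (hβ₁ : 1 < β) (hβ₂ : β < 2)
    (hconvex : IsLatticeConvex α E) (hconcave : IsLatticeConcave β E) :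
    EqualSpaces E
        (pointwiseProduct (kotheDual (powerSpace (1 / 2) (kotheDual E))) (kotheDual E)) ∧
      IsSeparableSpace (kotheDual (powerSpace (1 / 2) (kotheDual E))) := by
  obtain ⟨C, hC0, hC⟩ := hconcave.lowerEstimate hE (zero_lt_one.trans hβ₁)
  have hC2 : LowerEstimate 2 C E := hC.of_le hE (zero_lt_one.trans hβ₁) hβ₂
  have hle : ∀ x ∈ spaceOf E,
      pointwiseProduct (kotheDual (powerSpace (1 / 2) (kotheDual E))) (kotheDual E) x ≤
        (2 * C ^ 2 : ℝ≥0) * E x := fun x hx =>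
    hE.pointwiseProduct_le hC2 (hE.dualNorm_one_lt_top hα hconvex) hx
  have hmul : ∀ f g : LZero, g ∈ spaceOf (kotheDual E) →
      E (f * g) ≤ kotheDual (powerSpace (1 / 2) (kotheDual E)) f * kotheDual E g :=
    fun f g hg => hE.le_mul_of_product hβ₁.le hC hg
  refine ⟨⟨Set.Subset.antisymm (fun x hx => ?_) (fun x hx => ?_), 1, 2 * C ^ 2, one_pos,
    by positivity, fun x hx => ⟨?_, hle x hx⟩⟩, hE.isSeparableSpace hβ₁ hβ₂ hC⟩
  · exact (hle x hx).trans_lt (ENNReal.mul_lt_top ENNReal.coe_lt_top hx)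
  · obtain ⟨f, hf, g, hg, rfl⟩ := (mem_spaceOf_pointwiseProduct _ _ _).1 hx
    exact (hmul f g hg).trans_lt (ENNReal.mul_lt_top hf hg)
  · rw [ENNReal.coe_one, one_mul]
    refine le_iInf₂ fun f g => le_iInf₂ fun _ hg => le_iInf fun hxfg => ?_
    rw [hxfg]
    exact hmul f g hg
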